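/- **Setting.** Let $0\le p\le 1/2$, and let $(X_k,Y_k)$, $k\ge 1$, be i.i.d. pairs of bits with $P(X_k=x,Y_k=y)=\frac{1-p}{2}$ if $x=y$ and $\frac p2$ if $x\ne y$ (the doubly symmetric binary source DSBS($p$)). Put $Z_k=X_k\oplus Y_k$, so that $H(Z)=H_2(p):=-p\log_2p-(1-p)\log_2(1-p)$. Alice (user 1) has $X^n$, Bob (user 2) has $Y^n$, and Charlie (user 3) has no input and wants $Z^n$. Each pair of users is connected by a private, noiseless, bidirectional link. A *protocol* of block length $n$: at the start the users generate private random variables, which are independent of each other and of $(X^n,Y^n)$. In every round each user $i$ sends to every other user $j$ a (possibly empty) binary string, which is a function of user $i$'s input (if any), private randomness, and the messages received in earlier rounds. This string belongs to a prefix-free code which is determined by the earlier messages, in both directions, on the link $ij$. With probability 1 the protocol ends after finitely many rounds (all later messages are empty). Charlie outputs $\hat Z^n$, a function of his private randomness and of the messages he received. Let $M_{ij}$ be the whole transcript on the link $ij$, $L_{ij}$ the number of bits in it, and $$r_{ij,n}=\tfrac1n\mathbb E[L_{ij}],\qquad \rho_n=\tfrac1n H(M_{13},M_{23},M_{12}\mid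 X^n,Y^n).$$ A quadruple $(R_{13},R_{23},R_{12},\rho)\in\mathbb R^4$ is *achievable* if there are protocols $\Pi_n$, $n\ge 1$, with $r_{13,n}\le R_{13}$, $r_{23,n}\le R_{23}$, $r_{12,n}\le R_{12}$ and $\rho_n\le\rho$ for all $n$, such that, as $n\to\infty$, $P(\hat Z^n\neq Z^n)\to0$ and $$I(M_{13},M_{12};Y^n\mid X^n)\to0,\quad I(M_{23},M_{12};X^n\mid Y^n)\to0,\quad I(M_{13},M_{23};X^n,Y^n\mid Z^n)\to 0.$$ It is achievable *with perfect privacy* if the three informations can be made zero for every $n$, and *with weak privacy* if it is only required that the three informations divided by $n$ tend to $0$. The *rate region* $\mathcal R$ is the closure of the set of achievable quadruples in $\mathbb R^4$; $\mathcal R_{\mathrm{perfect}}$ and $\mathcal R_{\mathrm{weak}}$ are defined likewise. **Theorem.** For every $0\le p\le 1/2$, $$\mathcal R=\mathcal R_{\mathrm{perfect}}=\mathcal R_{\mathrm{weak}}=\{(R_{13},R_{23},R_{12},\rho)\in\mathbb R^4:\ \min(R_{13},R_{23},R_{12},\rho)\ge H(Z)=H_2(p)\}.$$ Moreover, for every $R>H_2(p)$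 there are integers $m_n\le nR$, matrices $\Lambda_n\in\mathbb F_2^{m_n\times n}$ and decoders $D_n:\mathbb F_2^{m_n}\to\mathbb F_2^n$ such that the following protocols achieve $(R,R,R,R)$ with perfect privacy: Alice draws a uniform key $K\in\mathbb F_2^{m_n}$ and sends $K$ to Bob and $K\oplus\Lambda_nX^n$ to Charlie; Bob then sends $K\oplus\Lambda_nY^n$ to Charlie; Charlie applies $D_n$ to the sum of the two vectors that he received. -/

import Mathlib

open MeasureTheory ProbabilityTheory Filter Topology
open scoped ENNReal

noncomputable section

namespace SecureXor

/-! ### Discrete information measures, in bits -/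

section Information

variable {Ω α β τ : Type*} [MeasurableSpace Ω]

/-- Shannon entropy `H(S) = - ∑ₐ P(S = a) log₂ P(S = a)` of a discrete random variable `S`
(one that takes its values in a countable set almost surely); it may be infinite. -/
def entropy (μ : Measure Ω) (S : Ω → α) : ℝ≥0∞ :=
  ∑' a, ENNReal.ofReal (Real.negMulLog (μ.real (S ⁻¹' {a})) / Real.log 2)

/-- Conditional entropy `H(S | T) = ∑_b P(T = b) H(S | T = b)` of discrete random variables. -/
def condEntropy (μ : Measure Ω) (S : Ω → α) (T : Ω → β) : ℝ≥0∞ :=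
  ∑' b, μ (T ⁻¹' {b}) * entropy (μ[|T ⁻¹' {b}]) S

/-- Conditional mutual information `I(S ; T | U) = H(T | U) - H(T | S, U)` of discrete random
variables, where `T` has a finite alphabet, so that both terms are finite. -/
def condMutualInfo [Finite τ] (μ : Measure Ω) (S : Ω → α) (T : Ω → τ) (U : Ω → β) : ℝ≥0∞ :=
  condEntropy μ T U - condEntropy μ T (fun ω => (S ω, U ω))

end Information

/-- The binary entropy function `H₂(p)`, in bits. -/
def H2 (p : ℝ) : ℝ := Real.binEntropy p / Real.log 2

/-! ### The source -/

/-- Bits; the exclusive or is the addition of `ZMod 2`. -/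
abbrev Bit : Type := ZMod 2

/-- The law of the doubly symmetric binary source with parameter `p`. -/
def dsbs (p : ℝ) : Measure (Bit × Bit) :=
  ∑ a : Bit × Bit, ENNReal.ofReal (if a.1 = a.2 then (1 - p) / 2 else p / 2) • Measure.dirac a

/-- The users: `0` is Alice (user 1), `1` is Bob (user 2), `2` is Charlie (user 3). -/
abbrev User : Type := Fin 3

/-- No codeword is a proper prefix of another one. -/
def IsPrefixFree (C : Set (List Bit)) : Prop :=
  ∀ u ∈ C, ∀ v ∈ C, u <+: v → u = v

/-! ### Protocols -/

/-- The data of an interactive three-user protocol with input block length `n`.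
In every round every user `i` sends to every other user `j` a (possibly empty) binary string,
which is a function of `i`'s input, `i`'s private randomness, and the list of what `i` has received
in the previous rounds (earliest round first; the entry `m` of a round gives the message `m k`
received from user `k`). The length of that list is the number of completed rounds.
Charlie has no input: the input argument of his message function is always the zero vector.
`code i j h` is the prefix-free code for the next message from `i` to `j`; it is determined by the
list `h` of the pairs (message from `i` to `j`, message from `j` to `i`) of the previous rounds. -/
structure Protocol (n : ℕ) where
  /-- the space of the private randomness of each user -/
  Rand : User → Type
  /-- its measurable sets -/
  [measRand : ∀ i, MeasurableSpace (Rand i)]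
  /-- the law of the private randomness of each user -/
  law : ∀ i, Measure (Rand i)
  /-- the laws are probability laws -/
  [probLaw : ∀ i, IsProbabilityMeasure (law i)]
  /-- the message from `i` to `j` -/
  msg : (i j : User) → (Fin n → Bit) → Rand i → List (User → List Bit) → List Bit
  measurableSet_msg : ∀ i j x h w, MeasurableSet {r | msg i j x r h = w}
  /-- Charlie's output, from his private randomness and all the messages he received
  (`m t k` is the one received from `k` in round `t`) -/
  output : Rand 2 → (ℕ → User → List Bit) → (Fin n → Bit)
  measurableSet_output : ∀ m z, MeasurableSet {r | output r m = z}
  /-- the code for the next message from `i` to `j` -/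
  code : (i j : User) → List (List Bit × List Bit) → Set (List Bit)
  prefixFree_code : ∀ i j h, IsPrefixFree (code i j h)

attribute [instance] Protocol.measRand Protocol.probLaw

namespace Protocol

variable {n : ℕ} (P : Protocol n)

/-- The sample space: the block of source pairs and the three private random variables. -/
abbrev Sample : Type := (Fin n → Bit × Bit) × (∀ i, P.Rand i)

/-- The source pairs are i.i.d.; the private random variables are independent of each other and
of the source. -/
def measure (p : ℝ) : Measure P.Sample :=
  (Measure.pi fun _ : Fin n => dsbs p).prod (Measure.pi P.law)

/-- Alice's input `Xⁿ`. -/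
def X (ω : P.Sample) : Fin n → Bit := fun k => (ω.1 k).1

/-- Bob's input `Yⁿ`. -/
def Y (ω : P.Sample) : Fin n → Bit := fun k => (ω.1 k).2

/-- The function `Zⁿ = Xⁿ ⊕ Yⁿ` that Charlie wants. -/
def Z (ω : P.Sample) : Fin n → Bit := P.X ω + P.Y ω

/-- The input of each user (Charlie has none). -/
def input (ω : P.Sample) : User → Fin n → Bit := ![P.X ω, P.Y ω, 0]

/-- All the messages of the next round (sender first), from those of the previous rounds. -/
def nextRound (ω : P.Sample) (h : List (User → User → List Bit)) : User → User → List Bit :=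
  fun i j => if i = j then [] else P.msg i j (P.input ω i) (ω.2 i) (h.map fun m k => m k i)

/-- All the messages of the first `t` rounds. -/
def history (ω : P.Sample) : ℕ → List (User → User → List Bit)
  | 0 => []
  | t + 1 => history ω t ++ [P.nextRound ω (history ω t)]

/-- The message from `i` to `j` in round `t` (rounds are numbered from `0`). -/
def sent (ω : P.Sample) (t : ℕ) (i j : User) : List Bit := P.nextRound ω (P.history ω t) i j

/-- The final transcript `M_{ij}` of the link between `i` and `j`. -/
def transcript (i j : User) (ω : P.Sample) : ℕ → List Bit × List Bit :=
  fun t => (P.sent ω t i j, P.sent ω t j i)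

/-- The number `L_{ij}` of bits exchanged on the link between `i` and `j`. -/
def linkLength (i j : User) (ω : P.Sample) : ℝ≥0∞ :=
  ∑' t, (((P.sent ω t i j).length : ℝ≥0∞) + ((P.sent ω t j i).length : ℝ≥0∞))

/-- Charlie's estimate of `Zⁿ`. -/
def estimate (ω : P.Sample) : Fin n → Bit :=
  P.output (ω.2 2) (fun t k => P.sent ω t k 2)

/-- With probability one, every message belongs to the prefix-free code which the previous
messages on its link determine, and the protocol ends after finitely many rounds. -/
structure IsValid (p : ℝ) : Prop where
  sent_mem_code : ∀ᵐ ω ∂(P.measure p), ∀ t i j, i ≠ j →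
    P.sent ω t i j ∈ P.code i j ((P.history ω t).map fun m => (m i j, m j i))
  terminates : ∀ᵐ ω ∂(P.measure p), ∃ T, ∀ t, T ≤ t → ∀ i j, P.sent ω t i j = []

/-- The rate `r_{ij} = E[L_{ij}] / n`. -/
def linkRate (p : ℝ) (i j : User) : ℝ≥0∞ := (∫⁻ ω, P.linkLength i j ω ∂(P.measure p)) / n

/-- The rate of private randomness `ρ = H(M₁₃, M₂₃, M₁₂ | Xⁿ, Yⁿ) / n`. -/
def randRate (p : ℝ) : ℝ≥0∞ :=
  condEntropy (P.measure p)
    (fun ω => (P.transcript 0 2 ω, P.transcript 1 2 ω, P.transcript 0 1 ω))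
    (fun ω => (P.X ω, P.Y ω)) / n

/-- The probability `P(Ẑⁿ ≠ Zⁿ)`. -/
def errorProb (p : ℝ) : ℝ≥0∞ := P.measure p {ω | P.estimate ω ≠ P.Z ω}

/-- The leakage `I(M₁₃, M₁₂ ; Yⁿ | Xⁿ)` to Alice. -/
def leakAlice (p : ℝ) : ℝ≥0∞ :=
  condMutualInfo (P.measure p) (fun ω => (P.transcript 0 2 ω, P.transcript 0 1 ω)) P.Y P.X

/-- The leakage `I(M₂₃, M₁₂ ; Xⁿ | Yⁿ)` to Bob. -/
def leakBob (p : ℝ) : ℝ≥0∞ :=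
  condMutualInfo (P.measure p) (fun ω => (P.transcript 1 2 ω, P.transcript 0 1 ω)) P.X P.Y

/-- The leakage `I(M₁₃, M₂₃ ; Xⁿ, Yⁿ | Zⁿ)` to Charlie. -/
def leakCharlie (p : ℝ) : ℝ≥0∞ :=
  condMutualInfo (P.measure p) (fun ω => (P.transcript 0 2 ω, P.transcript 1 2 ω))
    (fun ω => (P.X ω, P.Y ω)) P.Z

end Protocol

/-! ### Rate regions -/

/-- The sequence of protocols respects the rate quadruple `q = (R₁₃, R₂₃, R₁₂, ρ)` at every block
length, and its probability of error vanishes. -/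
structure Attains (p : ℝ) (S : (n : ℕ) → Protocol n) (q : ℝ × ℝ × ℝ × ℝ) : Prop where
  valid : ∀ n, 0 < n → (S n).IsValid p
  rate13 : ∀ n, 0 < n → ((S n).linkRate p 0 2 : EReal) ≤ (q.1 : EReal)
  rate23 : ∀ n, 0 < n → ((S n).linkRate p 1 2 : EReal) ≤ (q.2.1 : EReal)
  rate12 : ∀ n, 0 < n → ((S n).linkRate p 0 1 : EReal) ≤ (q.2.2.1 : EReal)
  randRate : ∀ n, 0 < n → ((S n).randRate p : EReal) ≤ (q.2.2.2 : EReal)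
  error : Tendsto (fun n => (S n).errorProb p) atTop (𝓝 0)

/-- Asymptotically vanishing information leakage. -/
structure IsPrivate (p : ℝ) (S : (n : ℕ) → Protocol n) : Prop where
  alice : Tendsto (fun n => (S n).leakAlice p) atTop (𝓝 0)
  bob : Tendsto (fun n => (S n).leakBob p) atTop (𝓝 0)
  charlie : Tendsto (fun n => (S n).leakCharlie p) atTop (𝓝 0)

/-- Weak privacy: the rates of information leakage vanish asymptotically. -/
structure IsWeaklyPrivate (p : ℝ) (S : (n : ℕ) → Protocol n) : Prop where
  alice : Tendsto (fun n => (S n).leakAlice p / n) atTop (𝓝 0)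
  bob : Tendsto (fun n => (S n).leakBob p / n) atTop (𝓝 0)
  charlie : Tendsto (fun n => (S n).leakCharlie p / n) atTop (𝓝 0)

/-- Perfect privacy: nothing leaks, at any block length. -/
structure IsPerfectlyPrivate (p : ℝ) (S : (n : ℕ) → Protocol n) : Prop where
  alice : ∀ n, 0 < n → (S n).leakAlice p = 0
  bob : ∀ n, 0 < n → (S n).leakBob p = 0
  charlie : ∀ n, 0 < n → (S n).leakCharlie p = 0

/-- The rate region: the closure of the set of achievable rate quadruples. -/
def rateRegion (p : ℝ) : Set (ℝ × ℝ × ℝ × ℝ) :=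
  closure {q | ∃ S : (n : ℕ) → Protocol n, Attains p S q ∧ IsPrivate p S}

/-- The rate region under weak privacy. -/
def weakRateRegion (p : ℝ) : Set (ℝ × ℝ × ℝ × ℝ) :=
  closure {q | ∃ S : (n : ℕ) → Protocol n, Attains p S q ∧ IsWeaklyPrivate p S}

/-- The rate region under perfect privacy. -/
def perfectRateRegion (p : ℝ) : Set (ℝ × ℝ × ℝ × ℝ) :=
  closure {q | ∃ S : (n : ℕ) → Protocol n, Attains p S q ∧ IsPerfectlyPrivate p S}

/-! ### The masked syndrome protocol -/

/-- The first `m` bits of a string, as a vector. -/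
def toVec (m : ℕ) (w : List Bit) : Fin m → Bit := fun k => w.getD k 0

/-- Who sends an `m`-bit message when (`t` is the round), all the other messages being empty. -/
def maskedLength (m t : ℕ) (i j : User) : ℕ :=
  if (t = 0 ∧ i = 0 ∧ j = 1) ∨ (t = 0 ∧ i = 0 ∧ j = 2) ∨ (t = 1 ∧ i = 1 ∧ j = 2) then m else 0

theorem isPrefixFree_length (l : ℕ) : IsPrefixFree {w | w.length = l} :=
  fun _ hu _ hv h => h.eq_of_length (hu.trans hv.symm)

/-- Alice draws `m` private uniform bits `K`. In the first round she sends `K` to Bob and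
`K ⊕ Λ Xⁿ` to Charlie; in the second round Bob sends `K ⊕ Λ Yⁿ` to Charlie, who adds the two
vectors that he received and applies the decoder `D`. Bob and Charlie have no randomness. -/
def maskedSyndrome {n m : ℕ} (Λ : Matrix (Fin m) (Fin n) Bit)
    (D : (Fin m → Bit) → (Fin n → Bit)) : Protocol n where
  Rand := fun _ => Fin m → Bit
  law := fun i => if i = 0 then uniformOn Set.univ else Measure.dirac 0
  probLaw := fun i => by
    split_ifs
    · exact isProbabilityMeasure_uniformOn Set.finite_univ Set.univ_nonempty
    · infer_instance
  msg := fun i j x r h =>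
    if h.length = 0 ∧ i = 0 ∧ j = 1 then List.ofFn r
    else if h.length = 0 ∧ i = 0 ∧ j = 2 then List.ofFn (r + Λ.mulVec x)
    else if h.length = 1 ∧ i = 1 ∧ j = 2 then
      List.ofFn (toVec m ((h.map fun a => a 0).headD []) + Λ.mulVec x)
    else []
  measurableSet_msg := fun _ _ _ _ _ => MeasurableSet.of_discrete
  output := fun _ a => D (toVec m (a 0 0) + toVec m (a 1 1))
  measurableSet_output := fun _ _ => MeasurableSet.of_discrete
  code := fun i j h => {w | w.length = maskedLength m h.length i j}
  prefixFree_code := fun _ _ _ => isPrefixFree_length _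

end SecureXor

end

noncomputable section

namespace SecureXor

/-! ### Logarithmic ratios -/

/-! Achievability. A random binary matrix Λ with slightly more than n H₂(p) rows is with high
probability injective enough on the typical values of Zⁿ for Charlie to recover Zⁿ from ΛZⁿ = ΛXⁿ +
ΛYⁿ (`exists_linear_codes`). The key K cancels when Charlie adds his two vectors. For given inputs
these have the law of (K, K + ΛZⁿ), which depends on Zⁿ only, while Alice and Bob each see only
functions of their own input and of K. Hence nothing leaks. Each link carries one vector of m bits,
and given the inputs all transcripts are functions of the m-bit key.

Converse. Write Mᵢⱼ for the transcripts; all bounds hold up to the leakages and a Fano term, which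
are o(n) even under weak privacy. Privacy against Bob keeps H(X | Y) ≥ n H₂(p) alive after M₂₃ is
added to the condition, and given Y the variables X and Z determine each other, so H(Z | M₂₃) is
about n H₂(p) or more. As Charlie finds Z from M₁₃ and M₂₃, the entropy of M₁₃ is at least that
large. Exchanging Alice and Bob bounds M₂₃. For M₁₂, privacy against Alice gives H(Z | M₁₃) ≥ n
H₂(p), and privacy against Charlie gives H(X, Y | Z, M₁₃) ≥ n. So M₁₃ is almost independent of (X,
Y), and H(X | Y, M₁₃) ≥ n H₂(p). But M₁₃ and M₁₂ cut Alice off from the others: given them and Y,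
Charlie's estimate is independent of X, although subtracting Y from it yields X up to a small error.
Hence M₁₃, M₁₂ and Y almost determine X, and M₁₂ must supply the missing entropy. The near
independence of M₁₃ and (X, Y) also turns the bound on H(M₁₃) into one on H(M₁₃ | X, Y), that is, on
the randomness.

Two facts connect this with protocols: the transcript of a link obeys Kraft's inequality, so its
entropy is at most its expected length (`IsValid.entropy_transcript_le`), and the two sides of a cut
are independent given what crosses it (`exists_measure_isView_eq_mul`). Perfect privacy implies
privacy, which implies weak privacy, so achievability for the first and the converse for the last
settle all three regions. -/

/-- The logarithm `log₂ (y / x)`, truncated at `0`. -/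
def logRatio (x y : ℝ≥0∞) : ℝ≥0∞ :=
  ENNReal.ofReal ((Real.log y.toReal - Real.log x.toReal) / Real.log 2)

/-- The constant `log₂ e`. -/
def logE : ℝ≥0∞ := ENNReal.ofReal (1 / Real.log 2)

theorem log_two_pos : 0 < Real.log 2 := Real.log_pos one_lt_two

theorem logE_ne_top : logE ≠ ⊤ := ENNReal.ofReal_ne_top

/-- Along an increasing chain the truncation is inactive and the logarithms telescope. This is the
pointwise form of the chain rule. -/
theorem logRatio_add {x y z : ℝ≥0∞} (hx : x ≠ 0) (hxy : x ≤ y) (hyz : y ≤ z) (hz : z ≠ ⊤) :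
    logRatio x z = logRatio x y + logRatio y z := by
  have hy : y ≠ ⊤ := ne_top_of_le_ne_top hz hyz
  have hxt : x ≠ ⊤ := ne_top_of_le_ne_top hy hxy
  have h0 : 0 < x.toReal := ENNReal.toReal_pos hx hxt
  have h1 : x.toReal ≤ y.toReal := ENNReal.toReal_mono hy hxy
  have h2 : y.toReal ≤ z.toReal := ENNReal.toReal_mono hz hyz
  have h3 := Real.log_le_log h0 h1
  have h4 := Real.log_le_log (h0.trans_le h1) h2
  unfold logRatio
  rw [← ENNReal.ofReal_add]
  · congr 1; ring
  · exact div_nonneg (by linarith) log_two_pos.le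
  · exact div_nonneg (by linarith) log_two_pos.le

/-- This is log t ≤ t - 1 at t = v / x, arranged without subtraction. Summed over symbols with
masses x and reference masses v whose total is not larger, the `logE` terms cancel and Gibbs'
inequality remains; each use below is a choice of reference v. -/
theorem mul_logRatio_gibbs {x y v : ℝ≥0∞} (hxy : x ≤ y) (hy : y ≠ ⊤) (hv : v ≠ ⊤)
    (h0 : v = 0 → x = 0) :
    x * logRatio x y + x * logE ≤ x * logRatio v y + v * logE := by
  rcases eq_or_ne x 0 with rfl | hx
  · simp
  have hv0 : v ≠ 0 := fun h => hx (h0 h)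
  have hxt : x ≠ ⊤ := ne_top_of_le_ne_top hy hxy
  have h0 : 0 < x.toReal := ENNReal.toReal_pos hx hxt
  have hv' : 0 < v.toReal := ENNReal.toReal_pos hv0 hv
  have h1 : x.toReal ≤ y.toReal := ENNReal.toReal_mono hy hxy
  have h3 := Real.log_le_log h0 h1
  have hl := log_two_pos
  have key : x.toReal * (Real.log v.toReal - Real.log x.toReal) ≤ v.toReal - x.toReal := by
    have := Real.log_le_sub_one_of_pos (div_pos hv' h0)
    rw [Real.log_div hv'.ne' h0.ne'] at this
    calc _ ≤ x.toReal * (v.toReal / x.toReal - 1) := by gcongr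
      _ = _ := by field_simp
  have e1 : x * logRatio x y + x * logE = ENNReal.ofReal
      (x.toReal * ((Real.log y.toReal - Real.log x.toReal) / Real.log 2) +
        x.toReal * (1 / Real.log 2)) := by
    rw [ENNReal.ofReal_add (by have : 0 ≤ Real.log y.toReal - Real.log x.toReal := by linarith
                               positivity) (by positivity),
      ENNReal.ofReal_mul h0.le, ENNReal.ofReal_mul h0.le, ENNReal.ofReal_toReal hxt]
    rfl
  have e2 : ENNReal.ofReal
      (x.toReal * ((Real.log y.toReal - Real.log v.toReal) / Real.log 2) +
        v.toReal * (1 / Real.log 2)) ≤ x * logRatio v y + v * logE := by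
    refine ENNReal.ofReal_add_le.trans ?_
    rw [ENNReal.ofReal_mul h0.le, ENNReal.ofReal_mul hv'.le, ENNReal.ofReal_toReal hxt,
      ENNReal.ofReal_toReal hv]
    rfl
  rw [e1]
  refine le_trans (ENNReal.ofReal_le_ofReal ?_) e2
  have : (x.toReal * (Real.log v.toReal - Real.log x.toReal)) / Real.log 2 ≤
      (v.toReal - x.toReal) / Real.log 2 := by gcongr
  have e3 : x.toReal * ((Real.log y.toReal - Real.log x.toReal) / Real.log 2) +
        x.toReal * (1 / Real.log 2) = x.toReal * ((Real.log y.toReal - Real.log v.toReal) /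
        Real.log 2) + v.toReal * (1 / Real.log 2)
        + ((x.toReal * (Real.log v.toReal - Real.log x.toReal)) / Real.log 2
        - (v.toReal - x.toReal) / Real.log 2) := by ring
  linarith

/-! ### Discrete random variables -/

section Discrete

variable {Ω α β γ τ : Type*}

theorem preimage_prodMk (S : Ω → α) (T : Ω → β) (a : α) (b : β) :
    (fun ω => (S ω, T ω)) ⁻¹' {(a, b)} = S ⁻¹' {a} ∩ T ⁻¹' {b} := by
  ext ω; simp

variable [MeasurableSpace Ω] {μ : Measure Ω}

/-- A random variable which almost surely takes its values in a countable set. -/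
structure IsDiscrete (μ : Measure Ω) (S : Ω → α) : Prop where
  measurableSet_fiber : ∀ a, MeasurableSet (S ⁻¹' {a})
  exists_countable : ∃ C : Set α, C.Countable ∧ ∀ᵐ ω ∂μ, S ω ∈ C

theorem IsDiscrete.of_countable [Countable α] {S : Ω → α}
    (h : ∀ a, MeasurableSet (S ⁻¹' {a})) : IsDiscrete μ S :=
  ⟨h, Set.univ, Set.countable_univ, by simp⟩

theorem IsDiscrete.prodMk {S : Ω → α} {T : Ω → β} (hS : IsDiscrete μ S) (hT : IsDiscrete μ T) :
    IsDiscrete μ (fun ω => (S ω, T ω)) := by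
  obtain ⟨C, hC, hSC⟩ := hS.exists_countable
  obtain ⟨D, hD, hTD⟩ := hT.exists_countable
  refine ⟨fun a => ?_, C ×ˢ D, hC.prod hD, ?_⟩
  · have : (fun ω => (S ω, T ω)) ⁻¹' {a} = S ⁻¹' {a.1} ∩ T ⁻¹' {a.2} := by
      ext ω; simp [Prod.ext_iff]
    rw [this]
    exact (hS.measurableSet_fiber _).inter (hT.measurableSet_fiber _)
  · filter_upwards [hSC, hTD] with ω h1 h2 using ⟨h1, h2⟩

/-- The law of total probability. The codomain may be uncountable, as it is for transcripts, but all
fibers outside a countable set are null. The event `E` need not be measurable. -/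
theorem IsDiscrete.tsum_inter {S : Ω → α} (hS : IsDiscrete μ S) (E : Set Ω) :
    ∑' a, μ (E ∩ S ⁻¹' {a}) = μ E := by
  obtain ⟨C, hC, hSC⟩ := hS.exists_countable
  have h0 : μ (S ⁻¹' C)ᶜ = 0 := by
    have := ae_iff.1 hSC
    simpa [Set.compl_def] using this
  have hs : (Function.support fun a => μ (E ∩ S ⁻¹' {a})) ⊆ C := by
    intro a ha
    by_contra hn
    refine ha (measure_mono_null ?_ h0)
    rintro ω ⟨-, h⟩ h'
    simp only [Set.mem_preimage, Set.mem_singleton_iff] at h h'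
    exact hn (h ▸ h')
  rw [← tsum_subtype_eq_of_support_subset hs]
  have h := tsum_measure_preimage_singleton (μ := μ.restrict E) hC
    (fun y _ => hS.measurableSet_fiber y)
  simp_rw [Measure.restrict_apply (hS.measurableSet_fiber _), Set.inter_comm _ E] at h
  rw [h]
  refine le_antisymm ((measure_mono (Set.subset_univ _)).trans (by simp)) ?_
  have hm : MeasurableSet (S ⁻¹' C) := by
    rw [← Set.biUnion_preimage_singleton]
    exact MeasurableSet.biUnion hC fun _ _ => hS.measurableSet_fiber _
  rw [Measure.restrict_apply hm]
  calc μ E ≤ μ (S ⁻¹' C ∩ E ∪ (S ⁻¹' C)ᶜ) := measure_mono fun ω h => by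
        by_cases h' : ω ∈ S ⁻¹' C
        · exact Or.inl ⟨h', h⟩
        · exact Or.inr h'
    _ ≤ _ := (measure_union_le _ _).trans (by simp [h0])

theorem IsDiscrete.const (u : γ) : IsDiscrete μ (fun _ => u) :=
  ⟨fun a => MeasurableSet.const _, {u}, Set.countable_singleton u, by simp⟩

/-! ### Conditional entropy -/

theorem condEntropy_const [IsProbabilityMeasure μ] (S : Ω → α) (u : γ) :
    condEntropy μ S (fun _ => u) = entropy μ S := by
  unfold condEntropy
  rw [tsum_eq_single u]
  · simp
  · intro b hb
    have : (fun _ : Ω => u) ⁻¹' {b} = ∅ := by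
      ext; simp [hb.symm]
    simp [this]

/-- Multiplying by P(T = b) clears the denominators of the conditional law. What remains involves
joint masses only, so sums in `ℝ≥0∞` can be rearranged freely and infinite entropies need no
separate treatment. -/
theorem condEntropy_eq_tsum [IsFiniteMeasure μ] {T : Ω → β}
    (hT : ∀ b, MeasurableSet (T ⁻¹' {b})) (S : Ω → α) :
    condEntropy μ S T = ∑' b, ∑' a, μ (T ⁻¹' {b} ∩ S ⁻¹' {a}) *
      logRatio (μ (T ⁻¹' {b} ∩ S ⁻¹' {a})) (μ (T ⁻¹' {b})) := by
  unfold condEntropy entropy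
  refine tsum_congr fun b => ?_
  rw [← ENNReal.tsum_mul_left]
  refine tsum_congr fun a => ?_
  set y := μ (T ⁻¹' {b}) with hy
  set x := μ (T ⁻¹' {b} ∩ S ⁻¹' {a}) with hx
  have hyt : y ≠ ⊤ := measure_ne_top _ _
  have hxy : x ≤ y := measure_mono Set.inter_subset_left
  have hxt : x ≠ ⊤ := measure_ne_top _ _
  rw [Measure.real, cond_apply (hT b), ← hy, ← hx]
  rcases eq_or_ne x 0 with h0 | h0
  · simp [h0]
  have hx0 : 0 < x.toReal := ENNReal.toReal_pos h0 hxt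
  have hy0 : 0 < y.toReal := hx0.trans_le (ENNReal.toReal_mono hyt hxy)
  rw [logRatio]
  nth_rewrite 1 [← ENNReal.ofReal_toReal hyt]
  nth_rewrite 2 [← ENNReal.ofReal_toReal hxt]
  rw [← ENNReal.ofReal_mul hy0.le, ← ENNReal.ofReal_mul hx0.le]
  congr 1
  rw [ENNReal.toReal_mul, ENNReal.toReal_inv, Real.negMulLog,
    Real.log_mul (by positivity) hx0.ne', Real.log_inv]
  field_simp
  ring

variable [IsFiniteMeasure μ]

/-- The chain rule `H(S, T | U) = H(T | U) + H(S | T, U)`. -/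
theorem condEntropy_prod {S : Ω → α} {T : Ω → β} {U : Ω → γ} (hS : IsDiscrete μ S)
    (hT : IsDiscrete μ T) (hU : IsDiscrete μ U) :
    condEntropy μ (fun ω => (S ω, T ω)) U =
      condEntropy μ T U + condEntropy μ S (fun ω => (T ω, U ω)) := by
  rw [condEntropy_eq_tsum hU.1, condEntropy_eq_tsum hU.1,
    condEntropy_eq_tsum (hT.prodMk hU).1]
  have e : ∑' (b : β × γ), ∑' (a : α), μ ((fun ω => (T ω, U ω)) ⁻¹' {b} ∩ S ⁻¹' {a}) *
      logRatio (μ ((fun ω => (T ω, U ω)) ⁻¹' {b} ∩ S ⁻¹' {a}))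
        (μ ((fun ω => (T ω, U ω)) ⁻¹' {b})) =
      ∑' c, ∑' b, ∑' a, μ (U ⁻¹' {c} ∩ T ⁻¹' {b} ∩ S ⁻¹' {a}) *
      logRatio (μ (U ⁻¹' {c} ∩ T ⁻¹' {b} ∩ S ⁻¹' {a})) (μ (U ⁻¹' {c} ∩ T ⁻¹' {b})) := by
    rw [ENNReal.tsum_prod', ENNReal.tsum_comm]
    simp_rw [preimage_prodMk, Set.inter_comm (T ⁻¹' _) (U ⁻¹' _)]
  rw [e, ← ENNReal.tsum_add]
  refine tsum_congr fun c => ?_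
  rw [← ENNReal.tsum_add, ENNReal.tsum_prod', ENNReal.tsum_comm]
  refine tsum_congr fun b => ?_
  simp_rw [preimage_prodMk, Set.inter_comm (S ⁻¹' _) (T ⁻¹' _), ← Set.inter_assoc]
  set Y := U ⁻¹' {c} ∩ T ⁻¹' {b}
  -- Only the factor μ(Y) in front of the logarithm is to be expanded over the values of `S`; inside
  -- the logarithms the sum is folded back. Then the identity holds term by term.
  rw [← hS.tsum_inter Y]
  nth_rewrite 2 [hS.tsum_inter Y]
  rw [← ENNReal.tsum_mul_right, ← ENNReal.tsum_add, hS.tsum_inter Y]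
  refine tsum_congr fun a => ?_
  rcases eq_or_ne (μ (Y ∩ S ⁻¹' {a})) 0 with h0 | h0
  · simp [h0]
  rw [logRatio_add h0 (measure_mono Set.inter_subset_left)
    (measure_mono (Set.inter_subset_left : Y ⊆ U ⁻¹' {c})) (measure_ne_top _ _)]
  ring

/-- Conditioning reduces entropy. -/
theorem condEntropy_prod_right_le {S : Ω → α} (T : Ω → β) {U : Ω → γ} (hS : IsDiscrete μ S)
    (hU : IsDiscrete μ U) :
    condEntropy μ T (fun ω => (S ω, U ω)) ≤ condEntropy μ T U := by
  rw [condEntropy_eq_tsum hU.1, condEntropy_eq_tsum (hS.prodMk hU).1,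
    ENNReal.tsum_prod', ENNReal.tsum_comm]
  refine ENNReal.tsum_le_tsum fun c => ?_
  rw [ENNReal.tsum_comm]
  refine ENNReal.tsum_le_tsum fun b => ?_
  simp_rw [preimage_prodMk]
  set Y := U ⁻¹' {c}
  set X := Y ∩ T ⁻¹' {b}
  have hXY : μ X ≤ μ Y := measure_mono Set.inter_subset_left
  rcases eq_or_ne (μ X) 0 with h0 | h0
  · have : ∀ a, μ (S ⁻¹' {a} ∩ Y ∩ T ⁻¹' {b}) = 0 := fun a =>
      measure_mono_null (t := X) (fun ω (h : ω ∈ S ⁻¹' {a} ∩ Y ∩ T ⁻¹' {b}) => ⟨h.1.2, h.2⟩) h0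
    simp [this]
  have hY0 : μ Y ≠ 0 := fun h => h0 (le_antisymm (hXY.trans h.le) bot_le)
  have hq : μ X / μ Y ≠ ⊤ := ENNReal.div_ne_top (measure_ne_top _ _) hY0
  have hq0 : μ X / μ Y ≠ 0 := ENNReal.div_ne_zero.2 ⟨h0, measure_ne_top _ _⟩
  have eX : ∑' a, μ (S ⁻¹' {a} ∩ Y ∩ T ⁻¹' {b}) = μ X := by
    rw [← hS.tsum_inter X]
    refine tsum_congr fun a => ?_
    rw [Set.inter_assoc, Set.inter_comm]
  have eY : ∑' a, μ (S ⁻¹' {a} ∩ Y) * (μ X / μ Y) = μ X := by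
    simp_rw [Set.inter_comm _ Y]
    rw [ENNReal.tsum_mul_right, hS.tsum_inter Y, ENNReal.mul_div_cancel hY0 (measure_ne_top _ _)]
  -- Gibbs with reference P(S = a, U = c) P(T = b | U = c), the joint law if `S` and `T` were
  -- conditionally independent given `U`.
  have key : ∀ a, μ (S ⁻¹' {a} ∩ Y ∩ T ⁻¹' {b}) *
      logRatio (μ (S ⁻¹' {a} ∩ Y ∩ T ⁻¹' {b})) (μ (S ⁻¹' {a} ∩ Y)) +
      μ (S ⁻¹' {a} ∩ Y ∩ T ⁻¹' {b}) * logE ≤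
      μ (S ⁻¹' {a} ∩ Y ∩ T ⁻¹' {b}) * logRatio (μ X) (μ Y) +
      μ (S ⁻¹' {a} ∩ Y) * (μ X / μ Y) * logE := by
    intro a
    have hle : μ (S ⁻¹' {a} ∩ Y ∩ T ⁻¹' {b}) ≤ μ (S ⁻¹' {a} ∩ Y) :=
      measure_mono Set.inter_subset_left
    have hz : μ (S ⁻¹' {a} ∩ Y) * (μ X / μ Y) = 0 → μ (S ⁻¹' {a} ∩ Y ∩ T ⁻¹' {b}) = 0 := by
      intro h
      rcases mul_eq_zero.1 h with h | h
      · exact le_antisymm (hle.trans h.le) bot_le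
      · exact absurd h hq0
    refine (mul_logRatio_gibbs hle (measure_ne_top _ _)
      (ENNReal.mul_ne_top (measure_ne_top _ _) hq) hz).trans_eq ?_
    congr 1
    rcases eq_or_ne (μ (S ⁻¹' {a} ∩ Y)) 0 with hs | hs
    · rw [le_antisymm (hle.trans hs.le) bot_le]; simp
    · congr 1
      unfold logRatio
      congr 2
      rw [ENNReal.toReal_mul, ENNReal.toReal_div, Real.log_mul, Real.log_div]
      · ring
      · exact (ENNReal.toReal_pos h0 (measure_ne_top _ _)).ne'
      · exact (ENNReal.toReal_pos hY0 (measure_ne_top _ _)).ne'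
      · exact (ENNReal.toReal_pos hs (measure_ne_top _ _)).ne'
      · rw [← ENNReal.toReal_div]
        exact (ENNReal.toReal_pos hq0 hq).ne'
  have := ENNReal.tsum_le_tsum key
  rw [ENNReal.tsum_add, ENNReal.tsum_add, ENNReal.tsum_mul_right, ENNReal.tsum_mul_right,
    ENNReal.tsum_mul_right, eX, eY] at this
  exact (ENNReal.add_le_add_iff_right
    (ENNReal.mul_ne_top (measure_ne_top _ _) logE_ne_top)).1 this

/-- The relabelling may depend on the condition, which is what allows Y to be exchanged for Z = X +
Y given X. -/
theorem condEntropy_comp_of_injective {α' : Type*} {S : Ω → α} {S' : Ω → α'} {T : Ω → β}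
    (hT : ∀ b, MeasurableSet (T ⁻¹' {b}))
    (f : β → α → α') (hf : ∀ b, Function.Injective (f b)) (h : ∀ ω, S' ω = f (T ω) (S ω)) :
    condEntropy μ S' T = condEntropy μ S T := by
  rw [condEntropy_eq_tsum hT, condEntropy_eq_tsum hT]
  refine tsum_congr fun b => ?_
  have key : ∀ a, T ⁻¹' {b} ∩ S' ⁻¹' {f b a} = T ⁻¹' {b} ∩ S ⁻¹' {a} := by
    intro a
    ext ω
    simp only [Set.mem_inter_iff, Set.mem_preimage, Set.mem_singleton_iff]
    refine and_congr_right fun hb => ?_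
    rw [h, hb, (hf b).eq_iff]
  rw [← (hf b).tsum_eq]
  · simp_rw [key]
  · intro a' ha'
    by_contra hn
    refine ha' ?_
    have : T ⁻¹' {b} ∩ S' ⁻¹' {a'} = ∅ := by
      ext ω
      simp only [Set.mem_inter_iff, Set.mem_preimage, Set.mem_singleton_iff,
        Set.mem_empty_iff_false, iff_false, not_and]
      intro hb ha
      exact hn ⟨S ω, by rw [← ha, h, hb]⟩
    simp [this]

theorem condEntropy_comp_right_of_injective {S : Ω → α} {T : Ω → β} {T' : Ω → γ}
    (hT : ∀ b, MeasurableSet (T ⁻¹' {b})) (hT' : ∀ b, MeasurableSet (T' ⁻¹' {b}))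
    (f : β → γ) (hf : Function.Injective f) (h : ∀ ω, T' ω = f (T ω)) :
    condEntropy μ S T' = condEntropy μ S T := by
  rw [condEntropy_eq_tsum hT, condEntropy_eq_tsum hT', ← hf.tsum_eq]
  · refine tsum_congr fun b => ?_
    have : T' ⁻¹' {f b} = T ⁻¹' {b} := by
      ext ω; simp [h, hf.eq_iff]
    rw [this]
  · intro c hc
    by_contra hn
    refine hc ?_
    have : T' ⁻¹' {c} = ∅ := by
      ext ω
      simp only [Set.mem_preimage, Set.mem_singleton_iff, Set.mem_empty_iff_false, iff_false]
      intro hb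
      exact hn ⟨T ω, by rw [← hb, h]⟩
    simp [this]

/-- A function of the condition gives less information than the condition itself. -/
theorem condEntropy_le_of_comp (S : Ω → α) {T : Ω → β} {T' : Ω → γ}
    (hT : IsDiscrete μ T) (hT' : IsDiscrete μ T') (f : β → γ) (h : ∀ ω, T' ω = f (T ω)) :
    condEntropy μ S T ≤ condEntropy μ S T' := by
  refine le_trans (le_of_eq ?_) (condEntropy_prod_right_le S hT hT')
  exact (condEntropy_comp_right_of_injective hT.1 (hT.prodMk hT').1 (fun b => (b, f b))
    (fun a b h => (Prod.ext_iff.1 h).1) (fun ω => by rw [h])).symm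

/-- A function of a random variable has smaller entropy. -/
theorem condEntropy_comp_le {α' : Type*} {S : Ω → α} {S' : Ω → α'} {T : Ω → β}
    (hS : IsDiscrete μ S) (hS' : IsDiscrete μ S') (hT : IsDiscrete μ T) (f : α → α')
    (h : ∀ ω, S' ω = f (S ω)) : condEntropy μ S' T ≤ condEntropy μ S T := by
  -- The pair (S, S') is an injective function of S, so the chain rule writes H(S | T) as H(S' | T)
  -- plus a nonnegative term.
  have e := condEntropy_prod (μ := μ) hS hS' hT
  rw [condEntropy_comp_of_injective (S := S) hT.1 (fun _ a => (a, f a))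
    (fun _ a b h => (Prod.ext_iff.1 h).1) (fun ω => by rw [h])] at e
  rw [e]
  exact le_self_add

theorem entropy_prod [IsProbabilityMeasure μ] {S : Ω → α} {T : Ω → β} (hS : IsDiscrete μ S)
    (hT : IsDiscrete μ T) :
    entropy μ (fun ω => (S ω, T ω)) = entropy μ T + condEntropy μ S T := by
  have := condEntropy_prod hS hT (IsDiscrete.const (μ := μ) ())
  rw [condEntropy_const, condEntropy_const, condEntropy_comp_right_of_injective (T := T) hT.1
    (hT.prodMk (IsDiscrete.const ())).1 (fun b => (b, ())) (fun a b h => (Prod.ext_iff.1 h).1)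
    (fun _ => rfl)] at this
  exact this

theorem condEntropy_le_entropy [IsProbabilityMeasure μ] (S : Ω → α) {T : Ω → β}
    (hT : IsDiscrete μ T) : condEntropy μ S T ≤ entropy μ S := by
  rw [← condEntropy_const S ()]
  exact condEntropy_le_of_comp S hT (IsDiscrete.const ()) (fun _ => ()) (fun _ => rfl)

theorem entropy_comp_of_injective {α' : Type*} [IsProbabilityMeasure μ] {S : Ω → α} {S' : Ω → α'}
    (f : α → α') (hf : Function.Injective f) (h : ∀ ω, S' ω = f (S ω)) :
    entropy μ S' = entropy μ S := by
  rw [← condEntropy_const S (), ← condEntropy_const S' ()]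
  exact condEntropy_comp_of_injective (IsDiscrete.const (μ := μ) ()).1 (fun _ => f)
    (fun _ => hf) h

/-- Gibbs with the uniform reference y / |τ|. The total mass y is left free so that the bound
applies inside each fiber of a condition. -/
theorem tsum_mul_logRatio_le_log_card [Fintype τ] (x : τ → ℝ≥0∞) (y : ℝ≥0∞) (hy : y ≠ ⊤)
    (h : ∑ a, x a = y) :
    ∑ a, x a * logRatio (x a) y ≤
      y * ENNReal.ofReal (Real.log (Fintype.card τ) / Real.log 2) := by
  rcases eq_or_ne y 0 with h0 | h0
  · subst h
    have : ∀ a, x a = 0 := fun a => by simpa using Finset.sum_eq_zero_iff.1 h0 a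
    simp [this]
  have hne : Nonempty τ := by
    by_contra hn
    rw [not_nonempty_iff] at hn
    simp at h
    exact h0 h.symm
  have hN : (0 : ℝ) < Fintype.card τ := by exact_mod_cast Fintype.card_pos
  have hN0 : (Fintype.card τ : ℝ≥0∞) ≠ 0 := by exact_mod_cast Fintype.card_ne_zero
  have hv : y / Fintype.card τ ≠ ⊤ := ENNReal.div_ne_top hy hN0
  have hle : ∀ a, x a ≤ y := fun a =>
    h ▸ Finset.single_le_sum (fun _ _ => zero_le) (Finset.mem_univ a)
  have key : ∀ a, x a * logRatio (x a) y + x a * logE ≤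
      x a * ENNReal.ofReal (Real.log (Fintype.card τ) / Real.log 2) +
      y / Fintype.card τ * logE := by
    intro a
    refine (mul_logRatio_gibbs (hle a) hy hv fun h => ?_).trans_eq ?_
    · rw [ENNReal.div_eq_zero_iff] at h
      simp [h0] at h
    · congr 2
      unfold logRatio
      congr 2
      have : y.toReal ≠ 0 := (ENNReal.toReal_pos h0 hy).ne'
      rw [ENNReal.toReal_div, ENNReal.toReal_natCast, Real.log_div this hN.ne']
      ring
  have := Finset.sum_le_sum fun a (_ : a ∈ Finset.univ) => key a
  rw [Finset.sum_add_distrib, Finset.sum_add_distrib, ← Finset.sum_mul, ← Finset.sum_mul, h,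
    Finset.sum_const, Finset.card_univ, nsmul_eq_mul, ← mul_assoc,
    ENNReal.mul_div_cancel hN0 (by simp)] at this
  exact (ENNReal.add_le_add_iff_right (ENNReal.mul_ne_top hy logE_ne_top)).1 this

theorem entropy_eq [IsProbabilityMeasure μ] (S : Ω → α) :
    entropy μ S = ∑' a, μ (S ⁻¹' {a}) * logRatio (μ (S ⁻¹' {a})) 1 := by
  rw [← condEntropy_const S (), condEntropy_eq_tsum (IsDiscrete.const (μ := μ) ()).1]
  have : (fun _ : Ω => ()) ⁻¹' {()} = Set.univ := by ext; simp
  simp [this]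

theorem condEntropy_le_log_card [Fintype τ] [IsProbabilityMeasure μ] {S : Ω → τ} {T : Ω → β}
    (hS : IsDiscrete μ S) (hT : IsDiscrete μ T) :
    condEntropy μ S T ≤ ENNReal.ofReal (Real.log (Fintype.card τ) / Real.log 2) := by
  rw [condEntropy_eq_tsum hT.1]
  calc _ ≤ ∑' b, μ (T ⁻¹' {b}) * ENNReal.ofReal (Real.log (Fintype.card τ) / Real.log 2) := by
        refine ENNReal.tsum_le_tsum fun b => ?_
        rw [tsum_fintype]
        refine tsum_mul_logRatio_le_log_card _ _ (measure_ne_top _ _) ?_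
        rw [← hS.tsum_inter, tsum_fintype]
    _ = _ := by
        have := hT.tsum_inter Set.univ
        simp only [Set.univ_inter, measure_univ] at this
        rw [ENNReal.tsum_mul_right, this, one_mul]

/-- If `S` and `T` are conditionally independent given `U`, then conditioning on `S` as well does
not change the entropy of `T`. -/
theorem condEntropy_prod_right_of_condIndep {S : Ω → α} {T : Ω → β} {U : Ω → γ}
    (hS : IsDiscrete μ S) (hU : IsDiscrete μ U)
    (h : ∀ a b c, μ (U ⁻¹' {c} ∩ S ⁻¹' {a} ∩ T ⁻¹' {b}) * μ (U ⁻¹' {c}) =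
      μ (U ⁻¹' {c} ∩ S ⁻¹' {a}) * μ (U ⁻¹' {c} ∩ T ⁻¹' {b})) :
    condEntropy μ T (fun ω => (S ω, U ω)) = condEntropy μ T U := by
  rw [condEntropy_eq_tsum hU.1, condEntropy_eq_tsum (hS.prodMk hU).1,
    ENNReal.tsum_prod', ENNReal.tsum_comm]
  refine tsum_congr fun c => ?_
  rw [ENNReal.tsum_comm]
  refine tsum_congr fun b => ?_
  simp_rw [preimage_prodMk, Set.inter_comm (S ⁻¹' _)]
  set Y := U ⁻¹' {c}
  have e : μ (Y ∩ T ⁻¹' {b}) = ∑' a, μ (Y ∩ S ⁻¹' {a} ∩ T ⁻¹' {b}) := by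
    rw [← hS.tsum_inter]
    exact tsum_congr fun a => by rw [Set.inter_right_comm]
  nth_rewrite 1 [e]
  rw [← ENNReal.tsum_mul_right]
  refine tsum_congr fun a => ?_
  rcases eq_or_ne (μ (Y ∩ S ⁻¹' {a} ∩ T ⁻¹' {b})) 0 with h0 | h0
  · simp [h0]
  have n1 : μ (Y ∩ S ⁻¹' {a}) ≠ 0 := fun h' =>
    h0 (measure_mono_null Set.inter_subset_left h')
  have n2 : μ Y ≠ 0 := fun h' => n1 (measure_mono_null Set.inter_subset_left h')
  have n3 : μ (Y ∩ T ⁻¹' {b}) ≠ 0 := fun h' =>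
    h0 (measure_mono_null (t := Y ∩ T ⁻¹' {b}) (fun ω h => ⟨h.1.1, h.2⟩) h')
  have pos : ∀ {s}, μ s ≠ 0 → (μ s).toReal ≠ 0 := fun h =>
    (ENNReal.toReal_pos h (measure_ne_top _ _)).ne'
  -- The logarithm of the product formula says that the two ratios agree on every atom of positive
  -- mass.
  have := congrArg (fun x => Real.log x.toReal) (h a b c)
  simp only [ENNReal.toReal_mul] at this
  rw [Real.log_mul (pos h0) (pos n2), Real.log_mul (pos n1) (pos n3)] at this
  congr 1
  unfold logRatio
  congr 2
  linarith

/-- **Fano's inequality**. -/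
theorem condEntropy_le_fano [Fintype τ] [Nonempty τ] [IsProbabilityMeasure μ] {T V : Ω → τ}
    {U : Ω → γ} (hT : IsDiscrete μ T) (hV : IsDiscrete μ V) (hU : IsDiscrete μ U) :
    condEntropy μ T (fun ω => (V ω, U ω)) ≤ 1 + μ {ω | T ω ≠ V ω} *
      ENNReal.ofReal (Real.log (Fintype.card τ) / Real.log 2) := by
  classical
  -- With E the indicator of success, H(T | V) ≤ H(E | V) + H(T | E, V). The first term is at most
  -- one bit, and the second lives on the failure event only.
  let E : Ω → Bool := fun ω => decide (T ω = V ω)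
  have hE : IsDiscrete μ E := by
    refine IsDiscrete.of_countable fun a => ?_
    have : E ⁻¹' {a} = ⋃ t, ⋃ v, if decide (t = v) = a then T ⁻¹' {t} ∩ V ⁻¹' {v} else ∅ := by
      ext ω
      simp only [E, Set.mem_preimage, Set.mem_singleton_iff, Set.mem_iUnion]
      constructor
      · intro h
        exact ⟨T ω, V ω, by rw [if_pos h]; simp⟩
      · rintro ⟨t, v, h⟩
        split_ifs at h with h'
        · simp only [Set.mem_inter_iff, Set.mem_preimage, Set.mem_singleton_iff] at h
          rw [h.1, h.2, h']
        · exact h.elim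
    rw [this]
    refine MeasurableSet.iUnion fun t => MeasurableSet.iUnion fun v => ?_
    split_ifs
    · exact (hT.1 t).inter (hV.1 v)
    · exact MeasurableSet.empty
  have h1 : condEntropy μ T (fun ω => (V ω, U ω)) ≤ condEntropy μ T V :=
    condEntropy_le_of_comp T (hV.prodMk hU) hV Prod.fst fun _ => rfl
  have h2 : condEntropy μ T V ≤ condEntropy μ (fun ω => (T ω, E ω)) V :=
    condEntropy_comp_le (hT.prodMk hE) hT hV Prod.fst fun _ => rfl
  rw [condEntropy_prod hT hE hV] at h2
  refine h1.trans (h2.trans (add_le_add ?_ ?_))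
  · refine (condEntropy_le_log_card hE hV).trans_eq ?_
    simp [div_self log_two_pos.ne']
  rw [condEntropy_eq_tsum (hE.prodMk hV).1, ENNReal.tsum_prod', tsum_bool]
  have e0 : ∑' v, ∑' a, μ ((fun ω => (E ω, V ω)) ⁻¹' {(true, v)} ∩ T ⁻¹' {a}) *
      logRatio (μ ((fun ω => (E ω, V ω)) ⁻¹' {(true, v)} ∩ T ⁻¹' {a}))
        (μ ((fun ω => (E ω, V ω)) ⁻¹' {(true, v)})) = 0 := by
    simp only [ENNReal.tsum_eq_zero]
    intro v a
    by_cases hav : a = v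
    · subst hav
      have : (fun ω => (E ω, V ω)) ⁻¹' {(true, a)} ∩ T ⁻¹' {a} =
          (fun ω => (E ω, V ω)) ⁻¹' {(true, a)} := by
        ext ω
        simp only [E, Set.mem_inter_iff, Set.mem_preimage, Set.mem_singleton_iff, Prod.mk.injEq,
          decide_eq_true_eq, and_iff_left_iff_imp]
        rintro ⟨h, h'⟩
        rw [h, h']
      simp [this, logRatio]
    · have : (fun ω => (E ω, V ω)) ⁻¹' {(true, v)} ∩ T ⁻¹' {a} = ∅ := by
        ext ω
        simp only [E, Set.mem_inter_iff, Set.mem_preimage, Set.mem_singleton_iff, Prod.mk.injEq,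
          decide_eq_true_eq, Set.mem_empty_iff_false, iff_false, not_and, and_imp]
        intro h h' h''
        exact hav (by rw [← h'', h, h'])
      simp [this]
  rw [e0, add_zero]
  calc _ ≤ ∑' v, μ ((fun ω => (E ω, V ω)) ⁻¹' {(false, v)}) *
        ENNReal.ofReal (Real.log (Fintype.card τ) / Real.log 2) := by
        refine ENNReal.tsum_le_tsum fun b => ?_
        rw [tsum_fintype]
        refine tsum_mul_logRatio_le_log_card _ _ (measure_ne_top _ _) ?_
        rw [← hT.tsum_inter, tsum_fintype]
    _ = _ := by
        have := hV.tsum_inter (E ⁻¹' {false})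
        simp_rw [preimage_prodMk]
        rw [ENNReal.tsum_mul_right, this]
        congr 2
        ext ω
        simp [E]

/-- The entropy of a discrete random variable is at most its expected codeword length, if the
lengths satisfy the Kraft inequality. -/
theorem entropy_le_of_kraft [IsProbabilityMeasure μ] {S : Ω → α} (hS : IsDiscrete μ S)
    (V : Set α) (hV : ∀ᵐ ω ∂μ, S ω ∈ V) (l : α → ℕ)
    (hl : ∑' a : V, (2 : ℝ≥0∞)⁻¹ ^ l a ≤ 1) :
    entropy μ S ≤ ∑' a, μ (S ⁻¹' {a}) * (l a : ℝ≥0∞) := by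
  classical
  rw [entropy_eq]
  -- Gibbs with reference 2⁻ˡ on `V` and 0 elsewhere; Kraft bounds its total mass by one.
  have key : ∀ a, μ (S ⁻¹' {a}) * logRatio (μ (S ⁻¹' {a})) 1 + μ (S ⁻¹' {a}) * logE ≤
      μ (S ⁻¹' {a}) * (l a : ℝ≥0∞) + V.indicator (fun a => (2 : ℝ≥0∞)⁻¹ ^ l a) a * logE := by
    intro a
    by_cases ha : a ∈ V
    · rw [Set.indicator_of_mem ha]
      have hp : (2 : ℝ≥0∞)⁻¹ ^ l a ≠ ⊤ := by simp
      refine (mul_logRatio_gibbs (v := (2 : ℝ≥0∞)⁻¹ ^ l a) prob_le_one ENNReal.one_ne_top hp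
        fun h => ?_).trans_eq ?_
      · simp at h
      · congr 2
        unfold logRatio
        rw [ENNReal.toReal_pow, Real.log_pow, ENNReal.toReal_inv, Real.log_inv]
        simp [log_two_pos.ne']
    · have : μ (S ⁻¹' {a}) = 0 := by
        refine measure_mono_null ?_ (ae_iff.1 hV)
        intro ω h
        simp only [Set.mem_preimage, Set.mem_singleton_iff] at h
        simp [h, ha]
      simp [this]
  have := ENNReal.tsum_le_tsum key
  have e := hS.tsum_inter Set.univ
  simp only [Set.univ_inter, measure_univ] at e
  rw [ENNReal.tsum_add, ENNReal.tsum_add, ENNReal.tsum_mul_right, e, ENNReal.tsum_mul_right,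
    ← tsum_subtype] at this
  have h2 := this.trans (add_le_add le_rfl (mul_le_mul_left hl logE))
  rw [one_mul] at h2
  exact (ENNReal.add_le_add_iff_right logE_ne_top).1 h2

end Discrete

/-! ### Eventually constant sequences -/

/-- The sequences which are eventually equal to `e`. -/
def eventuallyEq {κ : Type*} (e : κ) : Set (ℕ → κ) := {a | ∃ T, ∀ t, T ≤ t → a t = e}

/-- Such a sequence is determined by a time and by its finitely many values before it. Thus
termination makes transcripts discrete although the space of all sequences is uncountable. -/
theorem countable_eventuallyEq {κ : Type*} [Countable κ] (e : κ) : (eventuallyEq e).Countable := by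
  have : eventuallyEq e = ⋃ T : ℕ, {a | ∀ t, T ≤ t → a t = e} := by
    ext a; simp [eventuallyEq]
  rw [this]
  refine Set.countable_iUnion fun T => ?_
  refine Set.MapsTo.countable_of_injOn (f := fun (a : ℕ → κ) (i : Fin T) => a i)
    (t := Set.univ) (fun _ _ => Set.mem_univ _) ?_ Set.countable_univ
  intro a ha b hb hab
  funext t
  by_cases h : t < T
  · exact congrFun hab ⟨t, h⟩
  · rw [ha t (not_lt.1 h), hb t (not_lt.1 h)]

/-! ### Runs of a protocol as a function of the inputs and of the private randomness -/

namespace Protocol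

variable {n : ℕ} (P : Protocol n)

/-- The messages of the next round, for arbitrary inputs. -/
def round (x : User → Fin n → Bit) (r : ∀ i, P.Rand i) (h : List (User → User → List Bit)) :
    User → User → List Bit :=
  fun i j => if i = j then [] else P.msg i j (x i) (r i) (h.map fun m k => m k i)

/-- The messages of the first rounds, for arbitrary inputs. -/
def run (x : User → Fin n → Bit) (r : ∀ i, P.Rand i) : ℕ → List (User → User → List Bit)
  | 0 => []
  | t + 1 => run x r t ++ [P.round x r (run x r t)]

/-- The messages of a round, for arbitrary inputs. -/
def runSent (x : User → Fin n → Bit) (r : ∀ i, P.Rand i) (t : ℕ) : User → User → List Bit :=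
  P.round x r (P.run x r t)

theorem history_eq_run (ω : P.Sample) (t : ℕ) : P.history ω t = P.run (P.input ω) ω.2 t := by
  induction t with
  | zero => rfl
  | succ t ih => rw [history, run, ih]; rfl

theorem sent_eq_runSent (ω : P.Sample) (t : ℕ) : P.sent ω t = P.runSent (P.input ω) ω.2 t := by
  funext i j
  rw [sent, history_eq_run]
  rfl

theorem run_succ (x : User → Fin n → Bit) (r : ∀ i, P.Rand i) (t : ℕ) :
    P.run x r (t + 1) = P.run x r t ++ [P.runSent x r t] := rfl

/-- The messages sent and received by user `i` are given by `w`. -/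
def IsView (i : User) (x : User → Fin n → Bit) (r : ∀ i, P.Rand i)
    (w : ℕ → User → List Bit × List Bit) : Prop :=
  ∀ t j, (P.runSent x r t i j, P.runSent x r t j i) = w t j

variable {P}

/-- A user's behaviour depends on the past only through the messages received, and these are part of
the view. -/
theorem IsView.run_map_eq {i : User} {x x' : User → Fin n → Bit} {r r' : ∀ i, P.Rand i}
    {w : ℕ → User → List Bit × List Bit} (h : P.IsView i x r w) (h' : P.IsView i x' r' w) (t : ℕ) :
    (P.run x r t).map (fun m k => m k i) = (P.run x' r' t).map (fun m k => m k i) := by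
  induction t with
  | zero => rfl
  | succ t ih =>
    rw [run_succ, run_succ, List.map_append, List.map_append, ih]
    congr 1
    simp only [List.map_cons, List.map_nil, List.cons.injEq, and_true]
    funext k
    exact (Prod.ext_iff.1 ((h t k).trans (h' t k).symm)).2

/-- If user `i` has the same view in two runs, then nothing changes in the second run when
user `i` is replaced by user `i` of the first run. -/
theorem IsView.run_update {i : User} {x x' : User → Fin n → Bit} {r r' : ∀ i, P.Rand i}
    {w : ℕ → User → List Bit × List Bit} (h : P.IsView i x r w) (h' : P.IsView i x' r' w) (t : ℕ) :
    P.run (Function.update x' i (x i)) (Function.update r' i (r i)) t = P.run x' r' t := by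
  induction t with
  | zero => rfl
  | succ t ih =>
    rw [run_succ, run_succ, ih]
    congr 2
    rw [runSent, ih, runSent]
    funext j k
    -- The transplanted user receives what it received in its own run, hence sends what `w`
    -- prescribes; the other users notice no difference.
    by_cases hj : j = i
    · subst hj
      have e := (Prod.ext_iff.1 ((h t k).trans (h' t k).symm)).1
      simp only [runSent, round] at e
      simp only [round, Function.update_self]
      rw [← e, h.run_map_eq h']
    · simp only [round, Function.update_of_ne hj]

theorem IsView.runSent_update {i : User} {x x' : User → Fin n → Bit} {r r' : ∀ i, P.Rand i}
    {w : ℕ → User → List Bit × List Bit} (h : P.IsView i x r w) (h' : P.IsView i x' r' w) :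
    P.runSent (Function.update x' i (x i)) (Function.update r' i (r i)) = P.runSent x' r' := by
  funext t
  have e := h.run_update h' (t + 1)
  rw [run_succ, run_succ, h.run_update h'] at e
  simpa using e

theorem IsView.update {i : User} {x x' : User → Fin n → Bit} {r r' : ∀ i, P.Rand i}
    {w : ℕ → User → List Bit × List Bit} (h : P.IsView i x r w) (h' : P.IsView i x' r' w) :
    P.IsView i (Function.update x' i (x i)) (Function.update r' i (r i)) w := by
  intro t j
  rw [h.runSent_update h']
  exact h' t j

variable (P)

theorem measurableSet_round (x : User → Fin n → Bit) (h : List (User → User → List Bit))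
    (m : User → User → List Bit) : MeasurableSet {r | P.round x r h = m} := by
  have : {r | P.round x r h = m} = ⋂ i, ⋂ j, {r | P.round x r h i j = m i j} := by
    ext r
    simp only [Set.mem_ofPred_eq, Set.mem_iInter]
    exact ⟨fun h i j => by rw [h], fun h => by funext i j; exact h i j⟩
  rw [this]
  refine MeasurableSet.iInter fun i => MeasurableSet.iInter fun j => ?_
  by_cases hij : i = j
  · simp [round, hij]
  · simp only [round, hij, if_false]
    exact measurable_pi_apply i (P.measurableSet_msg i j (x i) _ (m i j))

theorem measurableSet_run (x : User → Fin n → Bit) (t : ℕ) (h : List (User → User → List Bit)) :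
    MeasurableSet {r | P.run x r t = h} := by
  induction t generalizing h with
  | zero => simp [run]
  | succ t ih =>
    have : {r | P.run x r (t + 1) = h} = ⋃ h' : List (User → User → List Bit),
        ⋃ m : User → User → List Bit, {r | P.run x r t = h'} ∩ {r | P.round x r h' = m} ∩
        {_r | h' ++ [m] = h} := by
      ext r
      simp only [Set.mem_ofPred_eq, Set.mem_iUnion, Set.mem_inter_iff, run_succ]
      constructor
      · intro h
        exact ⟨_, _, ⟨rfl, rfl⟩, h⟩
      · rintro ⟨h', m, ⟨rfl, rfl⟩, h⟩
        exact h
    rw [this]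
    exact MeasurableSet.iUnion fun h' => MeasurableSet.iUnion fun m =>
      ((ih h').inter (P.measurableSet_round x h' m)).inter (MeasurableSet.const _)

theorem measurableSet_runSent (x : User → Fin n → Bit) (t : ℕ) (m : User → User → List Bit) :
    MeasurableSet {r | P.runSent x r t = m} := by
  have : {r | P.runSent x r t = m} = ⋃ h' : List (User → User → List Bit),
      {r | P.run x r t = h'} ∩ {r | P.round x r h' = m} := by
    ext r
    simp [runSent]
  rw [this]
  exact MeasurableSet.iUnion fun h' =>
    (P.measurableSet_run x t h').inter (P.measurableSet_round x h' m)

theorem measurableSet_runSent_mem (x : User → Fin n → Bit) (t : ℕ)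
    (A : Set (User → User → List Bit)) : MeasurableSet {r | P.runSent x r t ∈ A} := by
  have : {r | P.runSent x r t ∈ A} = ⋃ m ∈ A, {r | P.runSent x r t = m} := by
    ext r
    simp
  rw [this]
  exact MeasurableSet.biUnion A.to_countable fun m _ => P.measurableSet_runSent x t m

/-! ### The estimate of Charlie -/

open Classical in
/-- The output of Charlie, replaced by `0` when he does not stop receiving messages. -/
def output' (r : P.Rand 2) (m : ℕ → User → List Bit) : Fin n → Bit :=
  if m ∈ eventuallyEq (fun _ => []) then P.output r m else 0

/-- The estimate of Charlie, for arbitrary inputs. -/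
def runEstimate (x : User → Fin n → Bit) (r : ∀ i, P.Rand i) : Fin n → Bit :=
  P.output' (r 2) (fun t k => P.runSent x r t k 2)

/-- The output is only assumed measurable in the randomness for each fixed sequence of messages.
Restricting to the countably many terminating sequences makes the composite measurable, which is the
reason for `output'`. -/
theorem measurableSet_runEstimate (x : User → Fin n → Bit) (z : Fin n → Bit) :
    MeasurableSet {r | P.runEstimate x r = z} := by
  let E : Set (ℕ → User → List Bit) := eventuallyEq (fun _ => [])
  have hm : ∀ m : ℕ → User → List Bit,
      MeasurableSet {r | (fun t k => P.runSent x r t k 2) = m} := by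
    intro m
    have : {r | (fun t k => P.runSent x r t k 2) = m} =
        ⋂ t, {r | P.runSent x r t ∈ {u | (fun k => u k 2) = m t}} := by
      ext r
      simp only [Set.mem_ofPred_eq, Set.mem_iInter]
      exact ⟨fun h t => congrFun h t, fun h => funext h⟩
    rw [this]
    exact MeasurableSet.iInter fun t => P.measurableSet_runSent_mem x t _
  have hE : MeasurableSet {r | (fun t k => P.runSent x r t k 2) ∈ E} := by
    have : {r | (fun t k => P.runSent x r t k 2) ∈ E} =
        ⋃ m ∈ E, {r | (fun t k => P.runSent x r t k 2) = m} := by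
      ext r; simp
    rw [this]
    exact MeasurableSet.biUnion (countable_eventuallyEq _) fun m _ => hm m
  have : {r | P.runEstimate x r = z} =
      (⋃ m ∈ E, {r | (fun t k => P.runSent x r t k 2) = m} ∩ {r | P.output (r 2) m = z}) ∪
      {r | (fun t k => P.runSent x r t k 2) ∈ E}ᶜ ∩ {_r | (0 : Fin n → Bit) = z} := by
    ext r
    simp only [runEstimate, output', Set.mem_ofPred_eq, Set.mem_union, Set.mem_iUnion,
      Set.mem_inter_iff, Set.mem_compl_iff]
    split_ifs with h
    · constructor
      · intro hz
        exact Or.inl ⟨_, h, rfl, hz⟩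
      · rintro (⟨m, _, rfl, hz⟩ | h')
        · exact hz
        · exact absurd h h'.1
    · constructor
      · intro hz
        exact Or.inr ⟨h, hz⟩
      · rintro (⟨m, hm, rfl, hz⟩ | h')
        · exact absurd hm h
        · exact h'.2
  rw [this]
  refine MeasurableSet.union (MeasurableSet.biUnion (countable_eventuallyEq _) fun m _ =>
    (hm m).inter (measurable_pi_apply 2 (P.measurableSet_output m z))) ?_
  exact hE.compl.inter (MeasurableSet.const _)

/-! ### Cuts -/

/-- An event that ignores coordinate `i` is independent of that coordinate. Measurability is not
needed: splitting off the coordinate is a measurable equivalence and the rectangle formula for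
product measures holds for all sets. -/
theorem measure_pi_eq_mul {R : User → Type*} [∀ i, MeasurableSpace (R i)]
    (law : ∀ i, Measure (R i)) [∀ i, IsProbabilityMeasure (law i)] (i : User)
    {F : Set (R i)} {G : Set (∀ i, R i)}
    (hGi : ∀ r s, Function.update r i s ∈ G ↔ r ∈ G) :
    Measure.pi law {r | r i ∈ F ∧ r ∈ G} = law i F * Measure.pi law G := by
  have he := measurePreserving_piFinSuccAbove law i
  obtain ⟨ρ⟩ : Nonempty (R i) := (law i).nonempty_of_neZero
  let G' : Set (∀ j, R (i.succAbove j)) := {s | i.insertNth ρ s ∈ G}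
  have key : ∀ F : Set (R i), {r | r i ∈ F ∧ r ∈ G} =
      MeasurableEquiv.piFinSuccAbove R i ⁻¹' (F ×ˢ G') := by
    intro F
    ext r
    simp only [Set.mem_ofPred_eq, Set.mem_preimage, Set.mem_prod, G',
      MeasurableEquiv.piFinSuccAbove_apply, Fin.insertNthEquiv_symm_apply]
    refine and_congr_right fun _ => ?_
    rw [← hGi r ρ]
    have : Function.update r i ρ = i.insertNth ρ (i.removeNth r) := by
      rw [Fin.insertNth_removeNth]
    rw [this]
  have h1 : ∀ F : Set (R i), Measure.pi law {r | r i ∈ F ∧ r ∈ G} =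
      law i F * Measure.pi (fun j => law (i.succAbove j)) G' := by
    intro F
    rw [key, he.measure_preimage_equiv, Measure.prod_prod]
  have h2 := h1 Set.univ
  simp only [Set.mem_univ, true_and, Set.ofPred_mem_eq, measure_univ, one_mul] at h2
  rw [h1, h2]

/-- Given the view of user `i`, what happens on the side of user `i` and what happens on the side of
the two other users are independent. -/
theorem exists_measure_isView_eq_mul (i : User) (w : ℕ → User → List Bit × List Bit) :
    ∃ (F : Set (P.Rand i) → (Fin n → Bit) → ℝ≥0∞)
      (G : ((∀ i, P.Rand i) → (ℕ → User → User → List Bit) → Prop) → (User → Fin n → Bit) → ℝ≥0∞),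
      (∀ Q x ξ, G Q (Function.update x i ξ) = G Q x) ∧
      ∀ (x : User → Fin n → Bit) (A : Set (P.Rand i))
        (Q : (∀ i, P.Rand i) → (ℕ → User → User → List Bit) → Prop),
        (∀ r m ρ, Q (Function.update r i ρ) m ↔ Q r m) →
        Measure.pi P.law {r | P.IsView i x r w ∧ r i ∈ A ∧ Q r (P.runSent x r)} =
          F A (x i) * G Q x := by
  classical
  by_cases hex : ∃ x r, P.IsView i x r w
  -- Cut and paste against one reference run with view `w`: F tests user `i` among the others of the
  -- reference run, G tests the others against user `i` of the reference run. Both tests succeed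
  -- exactly when the actual run has view `w`, so that event is a rectangle.
  · obtain ⟨x₀, r₀, h₀⟩ := hex
    refine ⟨fun A ξ => P.law i {ρ | ρ ∈ A ∧
        P.IsView i (Function.update x₀ i ξ) (Function.update r₀ i ρ) w},
      fun Q x => Measure.pi P.law {r |
        P.IsView i (Function.update x i (x₀ i)) (Function.update r i (r₀ i)) w ∧
        Q (Function.update r i (r₀ i))
          (P.runSent (Function.update x i (x₀ i)) (Function.update r i (r₀ i)))},
      fun Q x ξ => by simp only [Function.update_idem], fun x A Q hQ => ?_⟩
    dsimp only
    rw [← measure_pi_eq_mul P.law i]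
    · congr 1
      ext r
      simp only [Set.mem_ofPred_eq]
      constructor
      · rintro ⟨h, hA, hq⟩
        refine ⟨⟨hA, h.update h₀⟩, h₀.update h, ?_⟩
        rw [h₀.runSent_update h, hQ]
        exact hq
      · rintro ⟨⟨hA, h1⟩, h2, hq⟩
        have e1 := h1.update h2
        have e2 := h1.runSent_update h2
        simp only [Function.update_self, Function.update_idem, Function.update_eq_self] at e1 e2
        refine ⟨e1, hA, ?_⟩
        rw [← e2, hQ] at hq
        exact hq
    · intro r s
      simp only [Set.mem_ofPred_eq, Function.update_idem]
  · refine ⟨0, 0, fun _ _ _ => rfl, fun x A Q _ => ?_⟩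
    have : {r | P.IsView i x r w ∧ r i ∈ A ∧ Q r (P.runSent x r)} = ∅ := by
      ext r
      simp only [Set.mem_ofPred_eq, Set.mem_empty_iff_false, iff_false]
      exact fun h => hex ⟨x, r, h.1⟩
    rw [this]
    simp

end Protocol

/-! ### The law of the source -/

/-- The probability mass function of the doubly symmetric binary source. -/
def dsbsPMF (p : ℝ) (a : Bit × Bit) : ℝ := if a.1 = a.2 then (1 - p) / 2 else p / 2

theorem dsbsPMF_nonneg {p : ℝ} (hp0 : 0 ≤ p) (hp1 : p ≤ 1 / 2) (a : Bit × Bit) :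
    0 ≤ dsbsPMF p a := by
  unfold dsbsPMF
  split_ifs <;> linarith

theorem dsbs_apply (p : ℝ) (A : Set (Bit × Bit)) [DecidablePred (· ∈ A)] :
    dsbs p A = ∑ a, if a ∈ A then ENNReal.ofReal (dsbsPMF p a) else 0 := by
  unfold dsbs
  rw [Measure.finsetSum_apply]
  refine Finset.sum_congr rfl fun a _ => ?_
  rw [Measure.smul_apply, Measure.dirac_apply' _ MeasurableSet.of_discrete, smul_eq_mul,
    Set.indicator_apply]
  simp [dsbsPMF]

theorem dsbs_singleton (p : ℝ) (a : Bit × Bit) : dsbs p {a} = ENNReal.ofReal (dsbsPMF p a) := by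
  classical
  rw [dsbs_apply]
  simp

theorem sum_bit {M : Type*} [AddCommMonoid M] (f : Bit → M) : ∑ a, f a = f 0 + f 1 :=
  Fin.sum_univ_two f

theorem isProbabilityMeasure_dsbs {p : ℝ} (hp0 : 0 ≤ p) (hp1 : p ≤ 1 / 2) :
    IsProbabilityMeasure (dsbs p) := by
  classical
  refine ⟨?_⟩
  rw [dsbs_apply]
  simp only [Set.mem_univ, if_true]
  rw [← ENNReal.ofReal_sum_of_nonneg fun a _ => dsbsPMF_nonneg hp0 hp1 a,
    Fintype.sum_prod_type, sum_bit, sum_bit, sum_bit]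
  simp [dsbsPMF]
  ring

/-! ### Conditional independence from a factorization -/

section CondIndep

variable {Ω α β γ δ : Type*} [MeasurableSpace Ω] {μ : Measure Ω}

/-- A factorization of the joint law gives conditional independence. -/
theorem measure_inter_mul_eq_of_factor {S : Ω → α} {W : Ω → δ} {U : Ω → γ}
    (hS : IsDiscrete μ S) (hW : IsDiscrete μ W) (φ : δ → β) (c : γ) (f : α → ℝ≥0∞)
    (g : δ → ℝ≥0∞) (h : ∀ a w, μ (U ⁻¹' {c} ∩ S ⁻¹' {a} ∩ W ⁻¹' {w}) = f a * g w) (a : α) (b : β) :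
    μ (U ⁻¹' {c} ∩ S ⁻¹' {a} ∩ (φ ∘ W) ⁻¹' {b}) * μ (U ⁻¹' {c}) =
      μ (U ⁻¹' {c} ∩ S ⁻¹' {a}) * μ (U ⁻¹' {c} ∩ (φ ∘ W) ⁻¹' {b}) := by
  classical
  have h1 : ∀ a, μ (U ⁻¹' {c} ∩ S ⁻¹' {a}) = f a * ∑' w, g w := fun a => by
    rw [← hW.tsum_inter, ← ENNReal.tsum_mul_left]
    exact tsum_congr fun w => h a w
  have h2 : ∀ a, μ (U ⁻¹' {c} ∩ S ⁻¹' {a} ∩ (φ ∘ W) ⁻¹' {b}) =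
      f a * ∑' w, if φ w = b then g w else 0 := fun a => by
    rw [← hW.tsum_inter, ← ENNReal.tsum_mul_left]
    refine tsum_congr fun w => ?_
    split_ifs with hw
    · rw [← h]
      congr 1
      ext ω
      simp only [Set.mem_inter_iff, Set.mem_preimage, Set.mem_singleton_iff, Function.comp]
      exact ⟨fun h => ⟨h.1.1, h.2⟩, fun h => ⟨⟨h.1, by rw [h.2, hw]⟩, h.2⟩⟩
    · rw [mul_zero]
      convert measure_empty (μ := μ) using 2
      ext ω
      simp only [Set.mem_inter_iff, Set.mem_preimage, Set.mem_singleton_iff, Function.comp,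
        Set.mem_empty_iff_false, iff_false]
      rintro ⟨⟨_, h1⟩, h2⟩
      exact hw (by rw [← h2, h1])
  have h3 : μ (U ⁻¹' {c}) = (∑' a, f a) * ∑' w, g w := by
    rw [← hS.tsum_inter, ← ENNReal.tsum_mul_right]
    exact tsum_congr h1
  have h4 : μ (U ⁻¹' {c} ∩ (φ ∘ W) ⁻¹' {b}) =
      (∑' a, f a) * ∑' w, if φ w = b then g w else 0 := by
    rw [← hS.tsum_inter, ← ENNReal.tsum_mul_right]
    refine tsum_congr fun a => ?_
    rw [← h2, Set.inter_right_comm]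
  rw [h1, h2, h3, h4]
  ring

end CondIndep

theorem log_card_bits (n : ℕ) :
    ENNReal.ofReal (Real.log (Fintype.card (Fin n → Bit)) / Real.log 2) = n := by
  have : Fintype.card (Fin n → Bit) = 2 ^ n := by simp
  rw [this]
  push_cast
  rw [Real.log_pow, mul_div_assoc, div_self log_two_pos.ne', mul_one, ENNReal.ofReal_natCast]

/-! ### Discreteness of the variables and independence across cuts -/

namespace Protocol

variable {n : ℕ} (P : Protocol n) {p : ℝ}

theorem isProbabilityMeasure_measure (hp0 : 0 ≤ p) (hp1 : p ≤ 1 / 2) :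
    IsProbabilityMeasure (P.measure p) := by
  have := isProbabilityMeasure_dsbs hp0 hp1
  unfold measure
  infer_instance

/-- The source takes finitely many values, so measurability can be checked on the slices where it is
fixed. -/
theorem measurableSet_sample {E : Set P.Sample} (h : ∀ s, MeasurableSet {r | (s, r) ∈ E}) :
    MeasurableSet E := by
  have : E = ⋃ s, {s} ×ˢ {r | (s, r) ∈ E} := by
    ext ⟨s, r⟩
    simp
  rw [this]
  exact MeasurableSet.iUnion fun s => (MeasurableSet.singleton s).prod (h s)

theorem isDiscrete_source {α : Type*} [Countable α] (μ : Measure P.Sample)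
    (f : (Fin n → Bit × Bit) → α) : IsDiscrete μ (fun ω : P.Sample => f ω.1) :=
  IsDiscrete.of_countable fun a => P.measurableSet_sample fun s => by
    change MeasurableSet {_r | f s = a}
    exact MeasurableSet.const _

theorem isDiscrete_X (μ : Measure P.Sample) : IsDiscrete μ P.X :=
  P.isDiscrete_source μ fun s k => (s k).1

theorem isDiscrete_Y (μ : Measure P.Sample) : IsDiscrete μ P.Y :=
  P.isDiscrete_source μ fun s k => (s k).2

theorem isDiscrete_Z (μ : Measure P.Sample) : IsDiscrete μ P.Z :=
  P.isDiscrete_source μ fun s => (fun k => (s k).1) + (fun k => (s k).2)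

/-- The estimate of Charlie, replaced by `0` where he does not stop receiving messages. -/
def estimate' (ω : P.Sample) : Fin n → Bit := P.runEstimate (P.input ω) ω.2

theorem isDiscrete_estimate' (μ : Measure P.Sample) : IsDiscrete μ P.estimate' :=
  IsDiscrete.of_countable fun z => P.measurableSet_sample fun s =>
    P.measurableSet_runEstimate ![fun k => (s k).1, fun k => (s k).2, 0] z

variable {P}

theorem IsValid.isDiscrete_transcript (hP : P.IsValid p) (i j : User) :
    IsDiscrete (P.measure p) (P.transcript i j) := by
  refine ⟨fun a => P.measurableSet_sample fun s => ?_, eventuallyEq ([], []),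
    countable_eventuallyEq _, ?_⟩
  · have : {r | (s, r) ∈ P.transcript i j ⁻¹' {a}} = ⋂ t, {r | P.runSent
        ![fun k => (s k).1, fun k => (s k).2, 0] r t ∈ {m | (m i j, m j i) = a t}} := by
      ext r
      simp only [Set.mem_preimage, Set.mem_singleton_iff, Set.mem_ofPred_eq, Set.mem_iInter]
      rw [funext_iff]
      refine forall_congr' fun t => ?_
      rw [transcript, sent_eq_runSent]
      rfl
    rw [this]
    exact MeasurableSet.iInter fun t => P.measurableSet_runSent_mem _ t _
  · filter_upwards [hP.terminates] with ω ⟨T, hT⟩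
    exact ⟨T, fun t ht => by simp [transcript, hT t ht]⟩

theorem IsValid.estimate_ae_eq (hP : P.IsValid p) :
    ∀ᵐ ω ∂P.measure p, P.estimate' ω = P.estimate ω := by
  filter_upwards [hP.terminates] with ω ⟨T, hT⟩
  have e : (fun t k => P.runSent (P.input ω) ω.2 t k 2) = fun t k => P.sent ω t k 2 := by
    funext t k
    rw [sent_eq_runSent]
  rw [estimate', runEstimate, estimate, e, output', if_pos]
  exact ⟨T, fun t ht => funext fun k => hT t ht k 2⟩

theorem IsValid.measure_estimate_ne (hP : P.IsValid p) :
    P.measure p {ω | P.Z ω ≠ P.estimate' ω} = P.errorProb p := by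
  refine measure_congr ?_
  filter_upwards [hP.estimate_ae_eq] with ω h
  refine propext ?_
  change P.Z ω ≠ P.estimate' ω ↔ P.estimate ω ≠ P.Z ω
  rw [h, ne_comm]

variable (P)

theorem measure_singleton_prod (hp0 : 0 ≤ p) (hp1 : p ≤ 1 / 2) (s : Fin n → Bit × Bit)
    (E : Set (∀ i, P.Rand i)) :
    P.measure p ({s} ×ˢ E) = Measure.pi (fun _ : Fin n => dsbs p) {s} * Measure.pi P.law E := by
  have := isProbabilityMeasure_dsbs hp0 hp1
  rw [measure, Measure.prod_prod]

/-- Given the messages on his links, the estimate of Charlie is independent of `(Xⁿ, Yⁿ)`. -/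
theorem exists_factor_charlie (hp0 : 0 ≤ p) (hp1 : p ≤ 1 / 2)
    (c : (ℕ → List Bit × List Bit) × (ℕ → List Bit × List Bit)) :
    ∃ (f : (Fin n → Bit) → ℝ≥0∞) (g : (Fin n → Bit) × (Fin n → Bit) → ℝ≥0∞), ∀ a w,
      P.measure p ((fun ω => (P.transcript 0 2 ω, P.transcript 1 2 ω)) ⁻¹' {c} ∩
        P.estimate' ⁻¹' {a} ∩ (fun ω => (P.X ω, P.Y ω)) ⁻¹' {w}) = f a * g w := by
  -- The swaps are there because the transcripts list the messages towards Charlie first, whereas a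
  -- view lists the sent messages first.
  let w : ℕ → User → List Bit × List Bit :=
    fun t => ![(c.1 t).swap, (c.2 t).swap, ([], [])]
  obtain ⟨F, G, -, hFG⟩ := P.exists_measure_isView_eq_mul 2 w
  -- Charlie is the lone side of the cut. Given the view his estimate depends on his own randomness
  -- only, and his input is always 0.
  refine ⟨fun a => F {ρ | P.output' ρ (fun t k => (w t k).2) = a} 0, fun z =>
    Measure.pi (fun _ : Fin n => dsbs p) {fun k => (z.1 k, z.2 k)} *
      G (fun _ _ => True) ![z.1, z.2, 0], fun a z => ?_⟩
  have h := hFG ![z.1, z.2, 0] {ρ | P.output' ρ (fun t k => (w t k).2) = a} (fun _ _ => True)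
    (fun _ _ _ => Iff.rfl)
  rw [mul_left_comm, show F _ 0 * G _ ![z.1, z.2, 0] = _ from h.symm,
    ← P.measure_singleton_prod hp0 hp1]
  congr 1
  ext ⟨s, r⟩
  simp only [Set.mem_inter_iff, Set.mem_preimage, Set.mem_singleton_iff, Set.mem_prod,
    Set.mem_ofPred_eq, and_true]
  have key : (P.X (s, r), P.Y (s, r)) = z ↔ s = fun k => (z.1 k, z.2 k) := by
    constructor
    · rintro rfl; rfl
    · rintro rfl; rfl
  rw [key, and_comm (b := s = _)]
  refine and_congr_right fun hs => ?_
  have hin : P.input (s, r) = ![z.1, z.2, 0] := by rw [hs]; rfl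
  have hv : (P.transcript 0 2 (s, r), P.transcript 1 2 (s, r)) = c ↔
      P.IsView 2 ![z.1, z.2, 0] r w := by
    rw [Prod.ext_iff, funext_iff, funext_iff, ← forall_and]
    refine forall_congr' fun t => ?_
    simp only [transcript, sent_eq_runSent, hin]
    rw [Fin.forall_fin_succ, Fin.forall_fin_two]
    have e : ((P.runSent ![z.1, z.2, 0] r t 2 2, P.runSent ![z.1, z.2, 0] r t 2 2) :
        List Bit × List Bit) = ([], []) := by simp [runSent, round]
    simp only [w]
    change _ ↔ (P.runSent _ r t 2 0, P.runSent _ r t 0 2) = (c.1 t).swap ∧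
      (P.runSent _ r t 2 1, P.runSent _ r t 1 2) = (c.2 t).swap ∧
      (P.runSent _ r t 2 2, P.runSent _ r t 2 2) = ([], [])
    rw [e, ← Prod.swap_inj, ← Prod.swap_inj (p := (P.runSent _ r t 1 2, _))]
    simp
  rw [hv]
  refine and_congr_right fun hview => ?_
  rw [estimate', runEstimate, hin]
  have : (fun t k => P.runSent ![z.1, z.2, 0] r t k 2) = fun t k => (w t k).2 := by
    funext t k
    rw [← hview t k]
  rw [this]

/-- Given the messages on the links of Alice and `Yⁿ`, the estimate of Charlie is independent of
`Xⁿ`. -/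
theorem exists_factor_alice (hp0 : 0 ≤ p) (hp1 : p ≤ 1 / 2)
    (c : ((ℕ → List Bit × List Bit) × (ℕ → List Bit × List Bit)) × (Fin n → Bit)) :
    ∃ (f : (Fin n → Bit) → ℝ≥0∞) (g : (Fin n → Bit) → ℝ≥0∞), ∀ a x,
      P.measure p ((fun ω => ((P.transcript 0 2 ω, P.transcript 0 1 ω), P.Y ω)) ⁻¹' {c} ∩
        (fun ω => P.estimate' ω - P.Y ω) ⁻¹' {a} ∩ P.X ⁻¹' {x}) = f a * g x := by
  let w : ℕ → User → List Bit × List Bit := fun t => ![([], []), c.1.2 t, c.1.1 t]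
  -- Here Alice is the lone side, and the estimate, computed from Charlie's randomness and messages,
  -- is an event of the other side.
  let Q : (Fin n → Bit) → (∀ i, P.Rand i) → (ℕ → User → User → List Bit) → Prop :=
    fun a r m => P.output' (r 2) (fun t k => m t k 2) - c.2 = a
  obtain ⟨F, G, hG, hFG⟩ := P.exists_measure_isView_eq_mul 0 w
  refine ⟨fun a => G (Q a) ![0, c.2, 0], fun x =>
    Measure.pi (fun _ : Fin n => dsbs p) {fun k => (x k, c.2 k)} * F Set.univ x, fun a x => ?_⟩
  have h := hFG ![x, c.2, 0] Set.univ (Q a) (fun r m ρ => by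
    simp only [Q]
    rw [Function.update_of_ne (by decide)])
  -- The factor of the other side ignores Alice's input, so it may be evaluated at 0 for every `x`.
  have hG' : G (Q a) ![0, c.2, 0] = G (Q a) ![x, c.2, 0] := by
    rw [← hG (Q a) ![x, c.2, 0] 0]
    congr 1
    funext i
    fin_cases i <;> simp [Function.update]
  dsimp only
  rw [hG', mul_left_comm, mul_comm (G _ _),
    show F Set.univ x * G (Q a) ![x, c.2, 0] = _ from h.symm,
    ← P.measure_singleton_prod hp0 hp1]
  congr 1
  ext ⟨s, r⟩
  simp only [Set.mem_inter_iff, Set.mem_preimage, Set.mem_singleton_iff, Set.mem_prod,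
    Set.mem_ofPred_eq, Set.mem_univ, true_and]
  have key : s = (fun k => (x k, c.2 k)) ↔ P.X (s, r) = x ∧ P.Y (s, r) = c.2 := by
    constructor
    · rintro rfl; exact ⟨rfl, rfl⟩
    · rintro ⟨rfl, hy⟩; rw [← hy]; rfl
  have hsplit : ((P.transcript 0 2 (s, r), P.transcript 0 1 (s, r)), P.Y (s, r)) = c ↔
      (P.transcript 0 2 (s, r), P.transcript 0 1 (s, r)) = c.1 ∧ P.Y (s, r) = c.2 := Prod.ext_iff
  rw [key, hsplit]
  have hmain : P.X (s, r) = x → P.Y (s, r) = c.2 →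
      (((P.transcript 0 2 (s, r), P.transcript 0 1 (s, r)) = c.1 ∧
        P.estimate' (s, r) - P.Y (s, r) = a) ↔
      (P.IsView 0 ![x, c.2, 0] r w ∧ Q a r (P.runSent ![x, c.2, 0] r))) := by
    intro hx hy
    have hin : P.input (s, r) = ![x, c.2, 0] := by rw [input, hx, hy]
    have hv : (P.transcript 0 2 (s, r), P.transcript 0 1 (s, r)) = c.1 ↔
        P.IsView 0 ![x, c.2, 0] r w := by
      rw [Prod.ext_iff, funext_iff, funext_iff, ← forall_and]
      refine forall_congr' fun t => ?_
      simp only [transcript, sent_eq_runSent, hin]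
      rw [Fin.forall_fin_succ, Fin.forall_fin_two]
      have e : ((P.runSent ![x, c.2, 0] r t 0 0, P.runSent ![x, c.2, 0] r t 0 0) :
          List Bit × List Bit) = ([], []) := by simp [runSent, round]
      simp only [w]
      change _ ↔ (P.runSent _ r t 0 0, P.runSent _ r t 0 0) = ([], []) ∧
        (P.runSent _ r t 0 1, P.runSent _ r t 1 0) = c.1.2 t ∧
        (P.runSent _ r t 0 2, P.runSent _ r t 2 0) = c.1.1 t
      rw [e]
      simp [and_comm]
    rw [hv, hy, estimate', runEstimate, hin]
  tauto

variable {P}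

/-- Charlie can compute `Zⁿ` with small error from the messages on his links alone. -/
theorem IsValid.condEntropy_Z_le (hp0 : 0 ≤ p) (hp1 : p ≤ 1 / 2) (hP : P.IsValid p) :
    condEntropy (P.measure p) P.Z (fun ω => (P.transcript 0 2 ω, P.transcript 1 2 ω)) ≤
      1 + P.errorProb p * n := by
  have := P.isProbabilityMeasure_measure hp0 hp1
  have hU := (hP.isDiscrete_transcript 0 2).prodMk (hP.isDiscrete_transcript 1 2)
  -- The estimate also uses Charlie's private randomness. By the cut it may be added to the
  -- condition at no cost, and then Fano applies.
  rw [← condEntropy_prod_right_of_condIndep (P.isDiscrete_estimate' _) hU]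
  · refine (condEntropy_le_fano (P.isDiscrete_Z _) (P.isDiscrete_estimate' _) hU).trans_eq ?_
    rw [hP.measure_estimate_ne, log_card_bits]
  · intro a b c
    obtain ⟨f, g, h⟩ := P.exists_factor_charlie hp0 hp1 c
    exact measure_inter_mul_eq_of_factor (P.isDiscrete_estimate' _)
      ((P.isDiscrete_X _).prodMk (P.isDiscrete_Y _)) (fun w => w.1 + w.2) c f g h a b

/-- The messages on the links of Alice and `Yⁿ` determine `Xⁿ` with small error. -/
theorem IsValid.condEntropy_X_le (hp0 : 0 ≤ p) (hp1 : p ≤ 1 / 2) (hP : P.IsValid p) :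
    condEntropy (P.measure p) P.X
      (fun ω => ((P.transcript 0 2 ω, P.transcript 0 1 ω), P.Y ω)) ≤ 1 + P.errorProb p * n := by
  have := P.isProbabilityMeasure_measure hp0 hp1
  have hU := ((hP.isDiscrete_transcript 0 2).prodMk (hP.isDiscrete_transcript 0 1)).prodMk
    (P.isDiscrete_Y (P.measure p))
  -- This guess of X is wrong exactly when the estimate of Z is.
  have hV : IsDiscrete (P.measure p) (fun ω => P.estimate' ω - P.Y ω) := by
    refine IsDiscrete.of_countable fun z => ?_
    have : (fun ω => P.estimate' ω - P.Y ω) ⁻¹' {z} =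
        ⋃ y, P.estimate' ⁻¹' {z + y} ∩ P.Y ⁻¹' {y} := by
      ext ω
      simp [sub_eq_iff_eq_add]
    rw [this]
    exact MeasurableSet.iUnion fun y =>
      ((P.isDiscrete_estimate' (P.measure p)).1 _).inter ((P.isDiscrete_Y (P.measure p)).1 _)
  rw [← condEntropy_prod_right_of_condIndep hV hU]
  · refine (condEntropy_le_fano (P.isDiscrete_X _) hV hU).trans_eq ?_
    rw [← hP.measure_estimate_ne, log_card_bits]
    congr 4
    ext ω
    simp [Z, eq_sub_iff_add_eq]
  · intro a b c
    obtain ⟨f, g, h⟩ := P.exists_factor_alice hp0 hp1 c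
    exact measure_inter_mul_eq_of_factor hV (P.isDiscrete_X _) id c f g h a b

end Protocol

/-! ### The Kraft inequality -/

/-- Two prefixes of one string are comparable, so the leading codewords coincide and can be
stripped. This is one step of parsing. -/
theorem IsPrefixFree.eq_of_append_prefix {C : Set (List Bit)} (hC : IsPrefixFree C)
    {u v s t : List Bit} (hu : u ∈ C) (hv : v ∈ C) (h : u ++ s <+: v ++ t) :
    u = v ∧ s <+: t := by
  have h1 : u <+: v ++ t := (List.prefix_append u s).trans h
  have huv : u = v := by
    rcases List.prefix_or_prefix_of_prefix h1 (List.prefix_append v t) with h2 | h2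
    · exact hC u hu v hv h2
    · exact (hC v hv u hu h2).symm
  subst huv
  exact ⟨rfl, (List.prefix_append_right_inj u).1 h⟩

theorem IsPrefixFree.uniquelyDecodable {C : Set (List Bit)} (hC : IsPrefixFree C)
    (h0 : [] ∉ C) : InformationTheory.UniquelyDecodable C := by
  intro L₁
  induction L₁ with
  | nil =>
    intro L₂ _ h2 he
    cases L₂ with
    | nil => rfl
    | cons v L₂ =>
      simp only [List.flatten_nil, List.flatten_cons] at he
      have := (List.append_eq_nil_iff.1 he.symm).1
      exact absurd (h2 v (by simp)) (this ▸ h0)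
  | cons u L₁ ih =>
    intro L₂ h1 h2 he
    cases L₂ with
    | nil =>
      simp only [List.flatten_nil, List.flatten_cons] at he
      have := (List.append_eq_nil_iff.1 he).1
      exact absurd (h1 u (by simp)) (this ▸ h0)
    | cons v L₂ =>
      simp only [List.flatten_cons] at he
      obtain ⟨rfl, -⟩ := hC.eq_of_append_prefix (h1 u (by simp)) (h2 v (by simp))
        (by rw [he])
      rw [ih L₂ (fun w hw => h1 w (by simp [hw])) (fun w hw => h2 w (by simp [hw]))
        (List.append_cancel_left he)]

/-- The empty word needs its own case, since it destroys unique decodability. A prefix-free code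
containing it has no other word; this is the code of a silent user. -/
theorem IsPrefixFree.sum_le_one {C : Finset (List Bit)} (hC : IsPrefixFree (C : Set (List Bit))) :
    ∑ w ∈ C, (2 : ℝ≥0∞)⁻¹ ^ w.length ≤ 1 := by
  by_cases h0 : [] ∈ C
  · have : C = {[]} := by
      ext w
      simp only [Finset.mem_singleton]
      exact ⟨fun hw => (hC [] h0 w hw List.nil_prefix).symm, fun hw => hw ▸ h0⟩
    rw [this]
    simp
  · have h := InformationTheory.kraft_mcmillan_inequality
      (hC.uniquelyDecodable (by simpa using h0))
    have h2 : ENNReal.ofReal (∑ w ∈ C, (1 / Fintype.card Bit : ℝ) ^ w.length) ≤ 1 := by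
      rw [← ENNReal.ofReal_one]
      exact ENNReal.ofReal_le_ofReal h
    rw [ENNReal.ofReal_sum_of_nonneg fun _ _ => by positivity] at h2
    refine le_trans (le_of_eq (Finset.sum_congr rfl fun w _ => ?_)) h2
    rw [ENNReal.ofReal_pow (by positivity)]
    congr 1
    rw [one_div, ENNReal.ofReal_inv_of_pos (by simp)]
    simp

/-! ### The entropy of a transcript -/

/-- The concatenation of the messages `a s, …, a (s + k - 1)`. -/
def concatFrom (a : ℕ → List Bit × List Bit) : ℕ → ℕ → List Bit
  | _, 0 => []
  | s, k + 1 => (a s).1 ++ ((a s).2 ++ concatFrom a (s + 1) k)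

theorem length_concatFrom (a : ℕ → List Bit × List Bit) (s k : ℕ) :
    (concatFrom a s k).length =
      ∑ t ∈ Finset.Ico s (s + k), ((a t).1.length + (a t).2.length) := by
  induction k generalizing s with
  | zero => simp [concatFrom]
  | succ k ih =>
    rw [concatFrom, List.length_append, List.length_append, ih,
      Finset.sum_eq_sum_Ico_succ_bot (show s < s + (k + 1) by omega), add_assoc, add_assoc,
      add_comm 1 k]

/-- The number of bits in a transcript (`0` if it is infinite). -/
def transcriptLength (a : ℕ → List Bit × List Bit) : ℕ :=
  ∑ᶠ t, ((a t).1.length + (a t).2.length)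

theorem transcriptLength_eq {a : ℕ → List Bit × List Bit} {T : ℕ}
    (h : ∀ t, T ≤ t → a t = ([], [])) : transcriptLength a = (concatFrom a 0 T).length := by
  rw [length_concatFrom, zero_add, transcriptLength, finsum_eq_sum_of_support_subset]
  intro t ht
  simp only [Finset.coe_Ico, Set.mem_Ico, zero_le, true_and]
  by_contra hn
  exact ht (by simp [h t (not_lt.1 hn)])

theorem transcriptLength_le (a : ℕ → List Bit × List Bit) :
    (transcriptLength a : ℝ≥0∞) ≤ ∑' t, (((a t).1.length : ℝ≥0∞) + (a t).2.length) := by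
  unfold transcriptLength
  by_cases hf : (Function.support fun t => (a t).1.length + (a t).2.length).Finite
  · rw [finsum_eq_sum _ hf]
    push_cast
    exact ENNReal.sum_le_tsum _
  · rw [finsum_of_infinite_support hf]
    simp

namespace Protocol

variable {n : ℕ} (P : Protocol n) {p : ℝ}

/-- The finite transcripts on the link between `i` and `j` which respect the codes. -/
def codeTranscripts (i j : User) : Set (ℕ → List Bit × List Bit) :=
  {a | a ∈ eventuallyEq ([], []) ∧ ∀ t, (a t).1 ∈ P.code i j ((List.range t).map a) ∧
    (a t).2 ∈ P.code j i ((List.range t).map fun s => (a s).swap)}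

variable {P}

/-- Parsing round by round: once the earlier rounds on the link agree, the codes in both directions
agree, and both messages of the next round can be read off. -/
theorem eq_of_concatFrom_prefix {i j : User} {a b : ℕ → List Bit × List Bit}
    (ha : a ∈ P.codeTranscripts i j) (hb : b ∈ P.codeTranscripts i j) (s k : ℕ)
    (hs : ∀ t < s, a t = b t) (h : concatFrom a s k <+: concatFrom b s k) :
    ∀ t < s + k, a t = b t := by
  induction k generalizing s with
  | zero => exact hs
  | succ k ih =>
    rw [concatFrom, concatFrom] at h
    have e1 : (List.range s).map a = (List.range s).map b :=
      List.map_congr_left fun t ht => hs t (List.mem_range.1 ht)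
    have e2 : (List.range s).map (fun t => (a t).swap) = (List.range s).map fun t => (b t).swap :=
      List.map_congr_left fun t ht => by rw [hs t (List.mem_range.1 ht)]
    obtain ⟨h1, h⟩ := (P.prefixFree_code i j _).eq_of_append_prefix (e1 ▸ (ha.2 s).1) (hb.2 s).1 h
    obtain ⟨h2, h⟩ := (P.prefixFree_code j i _).eq_of_append_prefix (e2 ▸ (ha.2 s).2) (hb.2 s).2 h
    have := ih (s + 1) (fun t ht => by
      rcases Nat.lt_succ_iff_lt_or_eq.1 ht with ht | rfl
      · exact hs t ht
      · exact Prod.ext h1 h2) h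
    intro t ht
    exact this t (by omega)

/-- Finitely many terminating transcripts share a time T after which they are silent. Their
concatenations up to T form a prefix-free set with the same lengths, so Kraft holds for every finite
subfamily. -/
theorem tsum_codeTranscripts_le (i j : User) :
    ∑' a : P.codeTranscripts i j, (2 : ℝ≥0∞)⁻¹ ^ transcriptLength a ≤ 1 := by
  classical
  rw [ENNReal.tsum_eq_iSup_sum]
  refine iSup_le fun A => ?_
  have hT : ∃ T, ∀ a ∈ A, ∀ t, T ≤ t → (a : ℕ → List Bit × List Bit) t = ([], []) := by
    choose T hT using fun a : P.codeTranscripts i j => a.2.1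
    exact ⟨A.sup T, fun a ha t ht => hT a t ((Finset.le_sup ha).trans ht)⟩
  obtain ⟨T, hT⟩ := hT
  have key : ∀ a ∈ A, ∀ b ∈ A,
      concatFrom (a : ℕ → List Bit × List Bit) 0 T <+: concatFrom b 0 T → a = b := by
    intro a ha b hb h
    have := eq_of_concatFrom_prefix a.2 b.2 0 T (by simp) h
    refine Subtype.ext (funext fun t => ?_)
    by_cases ht : t < T
    · exact this t (by omega)
    · rw [hT a ha t (not_lt.1 ht), hT b hb t (not_lt.1 ht)]
  have hpf : IsPrefixFree
      ((A.image fun a : P.codeTranscripts i j => concatFrom a.1 0 T : Finset _) :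
        Set (List Bit)) := by
    intro u hu v hv h
    simp only [Finset.coe_image, Set.mem_image, Finset.mem_coe] at hu hv
    obtain ⟨a, ha, rfl⟩ := hu
    obtain ⟨b, hb, rfl⟩ := hv
    rw [key a ha b hb h]
  refine le_trans (le_of_eq ?_) hpf.sum_le_one
  rw [Finset.sum_image fun a ha b hb h => key a ha b hb (by rw [h])]
  exact Finset.sum_congr rfl fun a ha => by rw [transcriptLength_eq (hT a ha)]

theorem history_eq_map (ω : P.Sample) (t : ℕ) :
    P.history ω t = (List.range t).map (P.sent ω) := by
  induction t with
  | zero => rfl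
  | succ t ih =>
    rw [List.range_succ, List.map_append, ← ih]
    rfl

theorem IsValid.transcript_mem (hP : P.IsValid p) {i j : User} (hij : i ≠ j) :
    ∀ᵐ ω ∂P.measure p, P.transcript i j ω ∈ P.codeTranscripts i j := by
  filter_upwards [hP.terminates, hP.sent_mem_code] with ω ⟨T, hT⟩ hc
  refine ⟨⟨T, fun t ht => by simp [transcript, hT t ht]⟩, fun t => ⟨?_, ?_⟩⟩
  · have := hc t i j hij
    rw [history_eq_map, List.map_map] at this
    exact this
  · have := hc t j i hij.symm
    rw [history_eq_map, List.map_map] at this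
    exact this

/-- The entropy of a transcript is at most its expected length. -/
theorem IsValid.entropy_transcript_le (hp0 : 0 ≤ p) (hp1 : p ≤ 1 / 2) (hP : P.IsValid p)
    {i j : User} (hij : i ≠ j) :
    entropy (P.measure p) (P.transcript i j) ≤ ∫⁻ ω, P.linkLength i j ω ∂P.measure p := by
  have := P.isProbabilityMeasure_measure hp0 hp1
  have hd := hP.isDiscrete_transcript i j
  refine (entropy_le_of_kraft hd _ (hP.transcript_mem hij) transcriptLength
    (tsum_codeTranscripts_le i j)).trans ?_
  -- The transcripts form an uncountable type, so the fibers are summed over finite sets, where they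
  -- are disjoint pieces of the integral.
  rw [ENNReal.tsum_eq_iSup_sum]
  refine iSup_le fun A => ?_
  calc ∑ a ∈ A, P.measure p (P.transcript i j ⁻¹' {a}) * (transcriptLength a : ℝ≥0∞)
      ≤ ∑ a ∈ A, ∫⁻ ω in P.transcript i j ⁻¹' {a}, P.linkLength i j ω ∂P.measure p := by
        refine Finset.sum_le_sum fun a _ => ?_
        rw [mul_comm, ← setLIntegral_const]
        refine setLIntegral_mono' (hd.1 a) fun ω hω => ?_
        simp only [Set.mem_preimage, Set.mem_singleton_iff] at hω
        rw [← hω]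
        exact transcriptLength_le _
    _ = ∫⁻ ω in ⋃ a ∈ A, P.transcript i j ⁻¹' {a}, P.linkLength i j ω ∂P.measure p := by
        rw [lintegral_biUnion_finset]
        · intro a _ b _ hab
          exact Set.disjoint_left.2 fun ω h1 h2 => hab (h1.symm.trans h2)
        · exact fun a _ => hd.1 a
    _ ≤ _ := setLIntegral_le_lintegral _ _

end Protocol

/-! ### Entropies of the source -/

theorem sum_prod_eq_pow {α : Type*} [Fintype α] (q : α → ℝ) (n : ℕ) :
    ∑ a : Fin n → α, ∏ k, q (a k) = (∑ a, q a) ^ n := by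
  classical
  have := Finset.prod_univ_sum (fun _ : Fin n => (Finset.univ : Finset α)) (fun _ a => q a)
  rw [Fintype.piFinset_univ] at this
  rw [← this]
  simp

/-- Entropies of independent coordinates add: `Real.negMulLog` obeys a Leibniz rule for products and
the other factors sum to one. -/
theorem sum_negMulLog_prod {α : Type*} [Fintype α] (q : α → ℝ) (hq : ∑ a, q a = 1) (n : ℕ) :
    ∑ a : Fin n → α, Real.negMulLog (∏ k, q (a k)) = n * ∑ a, Real.negMulLog (q a) := by
  induction n with
  | zero => simp
  | succ n ih =>
    rw [← (Fin.consEquiv fun _ => α).sum_comp, Fintype.sum_prod_type]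
    simp only [Fin.consEquiv_apply, Fin.prod_univ_succ, Fin.cons_zero, Fin.cons_succ,
      Real.negMulLog_mul, Finset.sum_add_distrib]
    simp only [← Finset.mul_sum, ← Finset.sum_mul, ih, sum_prod_eq_pow, hq, one_pow]
    push_cast
    ring

theorem entropy_of_iid {Ω α : Type*} [MeasurableSpace Ω] [Fintype α] {μ : Measure Ω} {n : ℕ}
    (S : Ω → Fin n → α) (q : α → ℝ) (hq0 : ∀ a, 0 ≤ q a) (hq : ∑ a, q a = 1)
    (hS : ∀ a, μ (S ⁻¹' {a}) = ∏ k, ENNReal.ofReal (q (a k))) :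
    entropy μ S = n * ENNReal.ofReal ((∑ a, Real.negMulLog (q a)) / Real.log 2) := by
  unfold entropy
  have h : ∀ a, μ.real (S ⁻¹' {a}) = ∏ k, q (a k) := fun a => by
    rw [Measure.real, hS, ENNReal.toReal_prod]
    exact Finset.prod_congr rfl fun k _ => ENNReal.toReal_ofReal (hq0 _)
  have h1 : ∀ a, q a ≤ 1 := fun a =>
    hq ▸ Finset.single_le_sum (fun b _ => hq0 b) (Finset.mem_univ a)
  simp_rw [h]
  rw [tsum_fintype, ← ENNReal.ofReal_sum_of_nonneg, ← Finset.sum_div, sum_negMulLog_prod q hq,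
    mul_div_assoc, ENNReal.ofReal_mul (by positivity), ENNReal.ofReal_natCast]
  intro a _
  exact div_nonneg (Real.negMulLog_nonneg (Finset.prod_nonneg fun k _ => hq0 _)
    (Finset.prod_le_one (fun k _ => hq0 _) fun k _ => h1 _)) log_two_pos.le

theorem sum_negMulLog_dsbsPMF (p : ℝ) :
    (∑ a, Real.negMulLog (dsbsPMF p a)) / Real.log 2 = 1 + H2 p := by
  rw [Fintype.sum_prod_type, sum_bit, sum_bit, sum_bit]
  simp only [dsbsPMF, zero_ne_one, one_ne_zero, if_true, if_false]
  rw [H2, Real.binEntropy_eq_negMulLog_add_negMulLog_one_sub,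
    div_eq_mul_inv (1 - p), div_eq_mul_inv p,
    Real.negMulLog_mul, Real.negMulLog_mul]
  have : Real.negMulLog 2⁻¹ = Real.log 2 / 2 := by
    rw [Real.negMulLog, Real.log_inv]; ring
  rw [this]
  have := log_two_pos.ne'
  field_simp
  ring

/-- The law of the sum of the two bits of the source. -/
def sumPMF (p : ℝ) (b : Bit) : ℝ := if b = 0 then 1 - p else p

theorem sumPMF_nonneg {p : ℝ} (hp0 : 0 ≤ p) (hp1 : p ≤ 1 / 2) (b : Bit) : 0 ≤ sumPMF p b := by
  unfold sumPMF
  split_ifs <;> linarith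

theorem sum_sumPMF (p : ℝ) : ∑ b, sumPMF p b = 1 := by
  rw [sum_bit]
  simp [sumPMF]

theorem dsbs_sum_eq {p : ℝ} (hp0 : 0 ≤ p) (hp1 : p ≤ 1 / 2) (b : Bit) :
    dsbs p {a | a.1 + a.2 = b} = ENNReal.ofReal (sumPMF p b) := by
  classical
  rw [dsbs_apply]
  have : ∀ a : Bit × Bit, (if a ∈ {a : Bit × Bit | a.1 + a.2 = b} then
      ENNReal.ofReal (dsbsPMF p a) else 0) =
      ENNReal.ofReal (if a.1 + a.2 = b then dsbsPMF p a else 0) := fun a => by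
    by_cases h : a.1 + a.2 = b <;> simp [h]
  simp_rw [this]
  rw [← ENNReal.ofReal_sum_of_nonneg]
  · congr 1
    rw [Fintype.sum_prod_type, sum_bit, sum_bit, sum_bit]
    have h2 : (1 : Bit) + 1 = 0 := rfl
    have hb : b = 0 ∨ b = 1 := by clear this; revert b; decide
    rcases hb with rfl | rfl <;> simp [dsbsPMF, sumPMF, h2]
  · intro a _
    split_ifs
    · exact dsbsPMF_nonneg hp0 hp1 a
    · exact le_rfl

theorem sum_negMulLog_sumPMF (p : ℝ) :
    (∑ b, Real.negMulLog (sumPMF p b)) / Real.log 2 = H2 p := by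
  rw [sum_bit, H2, Real.binEntropy_eq_negMulLog_add_negMulLog_one_sub]
  simp [sumPMF, add_comm]

theorem H2_nonneg {p : ℝ} (hp0 : 0 ≤ p) (hp1 : p ≤ 1 / 2) : 0 ≤ H2 p :=
  div_nonneg (Real.binEntropy_nonneg hp0 (by linarith)) log_two_pos.le

theorem entropy_dsbs_sum {p : ℝ} (hp0 : 0 ≤ p) (hp1 : p ≤ 1 / 2) :
    entropy (dsbs p) (fun a => a.1 + a.2) = ENNReal.ofReal (H2 p) := by
  have := entropy_of_iid (μ := dsbs p) (fun a (_ : Fin 1) => a.1 + a.2) (sumPMF p)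
    (sumPMF_nonneg hp0 hp1) (sum_sumPMF p) (fun b => by
      rw [Fin.prod_univ_one, ← dsbs_sum_eq hp0 hp1]
      congr 1
      ext a
      simp [funext_iff])
  rw [sum_negMulLog_sumPMF, Nat.cast_one, one_mul] at this
  have hp := isProbabilityMeasure_dsbs hp0 hp1
  rw [← this]
  exact (entropy_comp_of_injective (fun b _ => b) (fun a b h => congrFun h 0)
    (fun _ => rfl)).symm

namespace Protocol

variable {n : ℕ} (P : Protocol n) {p : ℝ}

theorem measure_source (hp0 : 0 ≤ p) (hp1 : p ≤ 1 / 2) (E : Set (Fin n → Bit × Bit)) :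
    P.measure p (Prod.fst ⁻¹' E) = Measure.pi (fun _ : Fin n => dsbs p) E := by
  have := isProbabilityMeasure_dsbs hp0 hp1
  rw [← Set.prod_univ, measure, Measure.prod_prod, measure_univ, mul_one]

theorem entropy_XY (hp0 : 0 ≤ p) (hp1 : p ≤ 1 / 2) :
    entropy (P.measure p) (fun ω => (P.X ω, P.Y ω)) = n + n * ENNReal.ofReal (H2 p) := by
  have := P.isProbabilityMeasure_measure hp0 hp1
  have hd := isProbabilityMeasure_dsbs hp0 hp1
  rw [entropy_comp_of_injective (S := fun ω : P.Sample => ω.1)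
    (S' := fun ω => (P.X ω, P.Y ω))
    (fun s => (fun k => (s k).1, fun k => (s k).2)) _ (fun _ => rfl),
    entropy_of_iid _ (dsbsPMF p) (dsbsPMF_nonneg hp0 hp1), sum_negMulLog_dsbsPMF,
    ENNReal.ofReal_add zero_le_one (H2_nonneg hp0 hp1), ENNReal.ofReal_one, mul_add, mul_one]
  · have := measure_univ (μ := dsbs p)
    classical
    rw [dsbs_apply] at this
    simp only [Set.mem_univ, if_true] at this
    rw [← ENNReal.ofReal_sum_of_nonneg fun a _ => dsbsPMF_nonneg hp0 hp1 a,
      ENNReal.ofReal_eq_one] at this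
    exact this
  · intro a
    change P.measure p (Prod.fst ⁻¹' {a}) = _
    rw [P.measure_source hp0 hp1, Measure.pi_singleton]
    exact Finset.prod_congr rfl fun k _ => dsbs_singleton p _
  · intro s t h
    obtain ⟨h1, h2⟩ := Prod.ext_iff.1 h
    exact funext fun k => Prod.ext (congrFun h1 k) (congrFun h2 k)

theorem measure_Z (hp0 : 0 ≤ p) (hp1 : p ≤ 1 / 2) (z : Fin n → Bit) :
    P.measure p (P.Z ⁻¹' {z}) = ∏ k, ENNReal.ofReal (sumPMF p (z k)) := by
  have hd := isProbabilityMeasure_dsbs hp0 hp1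
  have : P.Z ⁻¹' {z} = Prod.fst ⁻¹' (Set.univ.pi fun k => {a : Bit × Bit | a.1 + a.2 = z k}) := by
    ext ω
    simp [Z, X, Y, funext_iff]
  rw [this, P.measure_source hp0 hp1, Measure.pi_pi]
  exact Finset.prod_congr rfl fun k _ => dsbs_sum_eq hp0 hp1 _

theorem entropy_Z (hp0 : 0 ≤ p) (hp1 : p ≤ 1 / 2) :
    entropy (P.measure p) P.Z = n * ENNReal.ofReal (H2 p) := by
  rw [entropy_of_iid _ (sumPMF p) (sumPMF_nonneg hp0 hp1) (sum_sumPMF p) (P.measure_Z hp0 hp1),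
    sum_negMulLog_sumPMF]

theorem entropy_le_block (hp0 : 0 ≤ p) (hp1 : p ≤ 1 / 2) {S : P.Sample → Fin n → Bit}
    (hS : IsDiscrete (P.measure p) S) : entropy (P.measure p) S ≤ n := by
  have := P.isProbabilityMeasure_measure hp0 hp1
  rw [← condEntropy_const S (), ← log_card_bits]
  exact condEntropy_le_log_card hS (IsDiscrete.const ())

/-- H(X, Y) = n + n H₂(p), and X accounts for at most n bits of it. -/
theorem le_condEntropy_Y (hp0 : 0 ≤ p) (hp1 : p ≤ 1 / 2) :
    n * ENNReal.ofReal (H2 p) ≤ condEntropy (P.measure p) P.Y P.X := by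
  have := P.isProbabilityMeasure_measure hp0 hp1
  have hX := P.isDiscrete_X (P.measure p)
  have hY := P.isDiscrete_Y (P.measure p)
  have h := entropy_prod hY hX
  rw [entropy_comp_of_injective (S := fun ω => (P.X ω, P.Y ω))
    (S' := fun ω => (P.Y ω, P.X ω)) Prod.swap Prod.swap_injective
    (fun _ => rfl), P.entropy_XY hp0 hp1] at h
  have h2 := h.le.trans (add_le_add (P.entropy_le_block hp0 hp1 hX) le_rfl)
  exact (ENNReal.add_le_add_iff_left (ENNReal.natCast_ne_top n)).1 h2

theorem le_condEntropy_X (hp0 : 0 ≤ p) (hp1 : p ≤ 1 / 2) :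
    n * ENNReal.ofReal (H2 p) ≤ condEntropy (P.measure p) P.X P.Y := by
  have := P.isProbabilityMeasure_measure hp0 hp1
  have hX := P.isDiscrete_X (P.measure p)
  have hY := P.isDiscrete_Y (P.measure p)
  have h := entropy_prod hX hY
  rw [P.entropy_XY hp0 hp1] at h
  have h2 := h.le.trans (add_le_add (P.entropy_le_block hp0 hp1 hY) le_rfl)
  exact (ENNReal.add_le_add_iff_left (ENNReal.natCast_ne_top n)).1 h2

theorem condEntropy_XY_Z (hp0 : 0 ≤ p) (hp1 : p ≤ 1 / 2) :
    condEntropy (P.measure p) (fun ω => (P.X ω, P.Y ω)) P.Z = n := by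
  have := P.isProbabilityMeasure_measure hp0 hp1
  have hX := P.isDiscrete_X (P.measure p)
  have hY := P.isDiscrete_Y (P.measure p)
  have h := entropy_prod (hX.prodMk hY) (P.isDiscrete_Z (P.measure p))
  rw [entropy_comp_of_injective (S := fun ω => (P.X ω, P.Y ω))
    (S' := fun ω => ((P.X ω, P.Y ω), P.Z ω)) (fun w => (w, w.1 + w.2))
    (fun a b h => (Prod.ext_iff.1 h).1) (fun _ => rfl), P.entropy_XY hp0 hp1,
    P.entropy_Z hp0 hp1, add_comm] at h
  exact ((ENNReal.add_right_inj (ENNReal.mul_ne_top (by simp) (by simp))).1 h).symm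

/-! ### The converse for a fixed block length -/

variable {P}

section Converse

variable (hp0 : 0 ≤ p) (hp1 : p ≤ 1 / 2) (hP : P.IsValid p)

include hp0 hp1 hP

/-- Alice's view hardly reduces her uncertainty about Y. Given X, this is uncertainty about Z, and
dropping M₁₂ and X from the condition only increases it. -/
theorem IsValid.le_condEntropy_Z_transcript02 :
    n * ENNReal.ofReal (H2 p) ≤
      P.leakAlice p + condEntropy (P.measure p) P.Z (P.transcript 0 2) := by
  have := P.isProbabilityMeasure_measure hp0 hp1
  have hX := P.isDiscrete_X (P.measure p)
  have hA := hP.isDiscrete_transcript 0 1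
  have hB := hP.isDiscrete_transcript 0 2
  calc n * ENNReal.ofReal (H2 p) ≤ condEntropy (P.measure p) P.Y P.X := P.le_condEntropy_Y hp0 hp1
    _ ≤ P.leakAlice p + condEntropy (P.measure p) P.Y
        (fun ω => ((P.transcript 0 2 ω, P.transcript 0 1 ω), P.X ω)) := le_tsub_add
    _ ≤ P.leakAlice p + condEntropy (P.measure p) P.Y (fun ω => (P.transcript 0 2 ω, P.X ω)) := by
        gcongr
        exact condEntropy_le_of_comp _ ((hB.prodMk hA).prodMk hX) (hB.prodMk hX)
          (fun u => (u.1.1, u.2)) (fun _ => rfl)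
    _ = P.leakAlice p + condEntropy (P.measure p) P.Z (fun ω => (P.transcript 0 2 ω, P.X ω)) := by
        rw [condEntropy_comp_of_injective (S := P.Y) (S' := P.Z) (hB.prodMk hX).1
          (fun u y => u.2 + y) (fun u => add_right_injective u.2) (fun _ => rfl)]
    _ ≤ _ := by
        gcongr
        exact condEntropy_le_of_comp _ (hB.prodMk hX) hB Prod.fst (fun _ => rfl)

theorem IsValid.le_condEntropy_Z_transcript12 :
    n * ENNReal.ofReal (H2 p) ≤
      P.leakBob p + condEntropy (P.measure p) P.Z (P.transcript 1 2) := by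
  have := P.isProbabilityMeasure_measure hp0 hp1
  have hY := P.isDiscrete_Y (P.measure p)
  have hA := hP.isDiscrete_transcript 0 1
  have hC := hP.isDiscrete_transcript 1 2
  calc n * ENNReal.ofReal (H2 p) ≤ condEntropy (P.measure p) P.X P.Y := P.le_condEntropy_X hp0 hp1
    _ ≤ P.leakBob p + condEntropy (P.measure p) P.X
        (fun ω => ((P.transcript 1 2 ω, P.transcript 0 1 ω), P.Y ω)) := le_tsub_add
    _ ≤ P.leakBob p + condEntropy (P.measure p) P.X (fun ω => (P.transcript 1 2 ω, P.Y ω)) := by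
        gcongr
        exact condEntropy_le_of_comp _ ((hC.prodMk hA).prodMk hY) (hC.prodMk hY)
          (fun u => (u.1.1, u.2)) (fun _ => rfl)
    _ = P.leakBob p + condEntropy (P.measure p) P.Z (fun ω => (P.transcript 1 2 ω, P.Y ω)) := by
        rw [condEntropy_comp_of_injective (S := P.X) (S' := P.Z) (hC.prodMk hY).1
          (fun u x => x + u.2) (fun u => add_left_injective u.2) (fun _ => rfl)]
    _ ≤ _ := by
        gcongr
        exact condEntropy_le_of_comp _ (hC.prodMk hY) hC Prod.fst (fun _ => rfl)

/-- Privacy against Bob leaves Z uncertain given M₂₃, yet M₁₃ and M₂₃ together almost determine Z.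
-/
theorem IsValid.le_entropy_transcript02 :
    n * ENNReal.ofReal (H2 p) ≤ entropy (P.measure p) (P.transcript 0 2) +
      (P.leakBob p + (1 + P.errorProb p * n)) := by
  have := P.isProbabilityMeasure_measure hp0 hp1
  have hZ := P.isDiscrete_Z (P.measure p)
  have hB := hP.isDiscrete_transcript 0 2
  have hC := hP.isDiscrete_transcript 1 2
  calc n * ENNReal.ofReal (H2 p)
      ≤ P.leakBob p + condEntropy (P.measure p) P.Z (P.transcript 1 2) :=
        hP.le_condEntropy_Z_transcript12 hp0 hp1
    _ ≤ P.leakBob p +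
        condEntropy (P.measure p) (fun ω => (P.Z ω, P.transcript 0 2 ω)) (P.transcript 1 2) := by
        gcongr
        exact condEntropy_comp_le (hZ.prodMk hB) hZ hC Prod.fst (fun _ => rfl)
    _ ≤ P.leakBob p +
        (entropy (P.measure p) (P.transcript 0 2) + (1 + P.errorProb p * n)) := by
        rw [condEntropy_prod hZ hB hC]
        gcongr
        · exact condEntropy_le_entropy _ hC
        · exact hP.condEntropy_Z_le hp0 hp1
    _ = _ := by ring

theorem IsValid.le_entropy_transcript12 :
    n * ENNReal.ofReal (H2 p) ≤ entropy (P.measure p) (P.transcript 1 2) +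
      (P.leakAlice p + (1 + P.errorProb p * n)) := by
  have := P.isProbabilityMeasure_measure hp0 hp1
  have hZ := P.isDiscrete_Z (P.measure p)
  have hB := hP.isDiscrete_transcript 0 2
  have hC := hP.isDiscrete_transcript 1 2
  calc n * ENNReal.ofReal (H2 p)
      ≤ P.leakAlice p + condEntropy (P.measure p) P.Z (P.transcript 0 2) :=
        hP.le_condEntropy_Z_transcript02 hp0 hp1
    _ ≤ P.leakAlice p +
        condEntropy (P.measure p) (fun ω => (P.Z ω, P.transcript 1 2 ω)) (P.transcript 0 2) := by
        gcongr
        exact condEntropy_comp_le (hZ.prodMk hC) hZ hB Prod.fst (fun _ => rfl)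
    _ ≤ P.leakAlice p +
        (entropy (P.measure p) (P.transcript 1 2) + (1 + P.errorProb p * n)) := by
        rw [condEntropy_prod hZ hC hB]
        gcongr
        · exact condEntropy_le_entropy _ hB
        · refine le_trans (le_of_eq ?_) (hP.condEntropy_Z_le hp0 hp1)
          exact condEntropy_comp_right_of_injective (hB.prodMk hC).1 (hC.prodMk hB).1 Prod.swap
            Prod.swap_injective (fun _ => rfl)
    _ = _ := by ring

/-- The transcript between Alice and Charlie is almost independent of `(Xⁿ, Yⁿ)`. -/
theorem IsValid.le_condEntropy_XY_transcript02 :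
    n + n * ENNReal.ofReal (H2 p) ≤ P.leakAlice p + P.leakCharlie p +
      condEntropy (P.measure p) (fun ω => (P.X ω, P.Y ω)) (P.transcript 0 2) := by
  have := P.isProbabilityMeasure_measure hp0 hp1
  have hX := P.isDiscrete_X (P.measure p)
  have hY := P.isDiscrete_Y (P.measure p)
  have hZ := P.isDiscrete_Z (P.measure p)
  have hB := hP.isDiscrete_transcript 0 2
  have hC := hP.isDiscrete_transcript 1 2
  have e : condEntropy (P.measure p) (fun ω => (P.X ω, P.Y ω)) (P.transcript 0 2) =
      condEntropy (P.measure p) P.Z (P.transcript 0 2) +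
      condEntropy (P.measure p) (fun ω => (P.X ω, P.Y ω))
        (fun ω => (P.Z ω, P.transcript 0 2 ω)) := by
    rw [← condEntropy_prod (hX.prodMk hY) hZ hB]
    exact (condEntropy_comp_of_injective (S := fun ω => (P.X ω, P.Y ω))
      (S' := fun ω => ((P.X ω, P.Y ω), P.Z ω)) hB.1
      (fun _ (w : (Fin n → Bit) × (Fin n → Bit)) => (w, w.1 + w.2))
      (fun _ a b h => (Prod.ext_iff.1 h).1) (fun _ => rfl)).symm
  -- Privacy against Alice protects Z from M₁₃; privacy against Charlie protects the remaining n
  -- bits of (X, Y) given Z.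
  have h1 : (n : ℝ≥0∞) ≤ P.leakCharlie p + condEntropy (P.measure p) (fun ω => (P.X ω, P.Y ω))
      (fun ω => ((P.transcript 0 2 ω, P.transcript 1 2 ω), P.Z ω)) :=
    (P.condEntropy_XY_Z hp0 hp1).symm.le.trans le_tsub_add
  have h2 : condEntropy (P.measure p) (fun ω => (P.X ω, P.Y ω))
      (fun ω => ((P.transcript 0 2 ω, P.transcript 1 2 ω), P.Z ω)) ≤
      condEntropy (P.measure p) (fun ω => (P.X ω, P.Y ω))
        (fun ω => (P.Z ω, P.transcript 0 2 ω)) :=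
    condEntropy_le_of_comp _ ((hB.prodMk hC).prodMk hZ) (hZ.prodMk hB) (fun u => (u.2, u.1.1))
      (fun _ => rfl)
  rw [e]
  refine (add_le_add (h1.trans (add_le_add le_rfl h2))
    (hP.le_condEntropy_Z_transcript02 hp0 hp1)).trans_eq ?_
  ring

/-- Given Y and M₁₃, about n H₂(p) bits of X remain unknown. Adding M₁₂ almost determines X, because
Alice is then cut off from the others. -/
theorem IsValid.le_entropy_transcript01 :
    n * ENNReal.ofReal (H2 p) ≤ entropy (P.measure p) (P.transcript 0 1) +
      (P.leakAlice p + P.leakCharlie p + (1 + P.errorProb p * n)) := by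
  have := P.isProbabilityMeasure_measure hp0 hp1
  have hX := P.isDiscrete_X (P.measure p)
  have hY := P.isDiscrete_Y (P.measure p)
  have hA := hP.isDiscrete_transcript 0 1
  have hB := hP.isDiscrete_transcript 0 2
  have h1 : condEntropy (P.measure p) P.X (fun ω => (P.Y ω, P.transcript 0 2 ω)) ≤
      entropy (P.measure p) (P.transcript 0 1) + (1 + P.errorProb p * n) := by
    refine (condEntropy_comp_le (hX.prodMk hA) hX (hY.prodMk hB) Prod.fst (fun _ => rfl)).trans ?_
    rw [condEntropy_prod hX hA (hY.prodMk hB)]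
    gcongr
    · exact condEntropy_le_entropy _ (hY.prodMk hB)
    · refine le_trans (le_of_eq ?_) (hP.condEntropy_X_le hp0 hp1)
      refine condEntropy_comp_right_of_injective ((hB.prodMk hA).prodMk hY).1
        (hA.prodMk (hY.prodMk hB)).1 (fun u => (u.1.2, u.2, u.1.1)) ?_ (fun _ => rfl)
      rintro ⟨⟨a, b⟩, c⟩ ⟨⟨a', b'⟩, c'⟩ h
      simp only [Prod.mk.injEq] at h ⊢
      tauto
  have h2 := hP.le_condEntropy_XY_transcript02 hp0 hp1
  rw [condEntropy_prod hX hY hB] at h2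
  have h3 := h2.trans (add_le_add le_rfl (add_le_add
    ((condEntropy_le_entropy _ hB).trans (P.entropy_le_block hp0 hp1 hY)) h1))
  refine (ENNReal.add_le_add_iff_left (ENNReal.natCast_ne_top n)).1 (h3.trans_eq ?_)
  ring

/-- The bound on H(M₁₃) passes to H(M₁₃ | X, Y), since their difference I(M₁₃ ; X, Y) is at most the
leakage to Alice plus that to Charlie. -/
theorem IsValid.le_condEntropy_transcripts :
    n * ENNReal.ofReal (H2 p) ≤ condEntropy (P.measure p)
      (fun ω => (P.transcript 0 2 ω, P.transcript 1 2 ω, P.transcript 0 1 ω))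
      (fun ω => (P.X ω, P.Y ω)) +
      (P.leakAlice p + P.leakBob p + P.leakCharlie p + (1 + P.errorProb p * n)) := by
  have := P.isProbabilityMeasure_measure hp0 hp1
  have hX := P.isDiscrete_X (P.measure p)
  have hY := P.isDiscrete_Y (P.measure p)
  have hA := hP.isDiscrete_transcript 0 1
  have hB := hP.isDiscrete_transcript 0 2
  have hC := hP.isDiscrete_transcript 1 2
  have e1 := entropy_prod hB (hX.prodMk hY)
  have e2 := entropy_prod (hX.prodMk hY) hB
  rw [entropy_comp_of_injective (S := fun ω => ((P.X ω, P.Y ω), P.transcript 0 2 ω))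
    (S' := fun ω => (P.transcript 0 2 ω, P.X ω, P.Y ω)) Prod.swap
    Prod.swap_injective (fun _ => rfl), e2, P.entropy_XY hp0 hp1] at e1
  have h1 : condEntropy (P.measure p) (P.transcript 0 2) (fun ω => (P.X ω, P.Y ω)) ≤
      condEntropy (P.measure p)
        (fun ω => (P.transcript 0 2 ω, P.transcript 1 2 ω, P.transcript 0 1 ω))
        (fun ω => (P.X ω, P.Y ω)) :=
    condEntropy_comp_le (hB.prodMk (hC.prodMk hA)) hB (hX.prodMk hY) Prod.fst (fun _ => rfl)
  -- Only H(X, Y) is cancelled below; the transcript itself is not assumed to have finite entropy.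
  have hfin : (n : ℝ≥0∞) + n * ENNReal.ofReal (H2 p) ≠ ⊤ :=
    ENNReal.add_ne_top.2 ⟨by simp, ENNReal.mul_ne_top (by simp) (by simp)⟩
  have h2 : entropy (P.measure p) (P.transcript 0 2) ≤ P.leakAlice p + P.leakCharlie p +
      condEntropy (P.measure p) (P.transcript 0 2) (fun ω => (P.X ω, P.Y ω)) := by
    refine (ENNReal.add_le_add_iff_left hfin).1 ?_
    calc _ ≤ (P.leakAlice p + P.leakCharlie p + condEntropy (P.measure p)
          (fun ω => (P.X ω, P.Y ω)) (P.transcript 0 2)) +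
          entropy (P.measure p) (P.transcript 0 2) :=
          add_le_add (hP.le_condEntropy_XY_transcript02 hp0 hp1) le_rfl
      _ = P.leakAlice p + P.leakCharlie p + (entropy (P.measure p) (P.transcript 0 2) +
          condEntropy (P.measure p) (fun ω => (P.X ω, P.Y ω)) (P.transcript 0 2)) := by ring
      _ = _ := by rw [e1]; ring
  refine (hP.le_entropy_transcript02 hp0 hp1).trans
    ((add_le_add (h2.trans (add_le_add le_rfl h1)) le_rfl).trans_eq ?_)
  ring

end Converse

end Protocol

/-! ### Random linear codes -/

/-- Evaluation at `v` has a linear section, which writes the desired value into a column where `v`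
is 1. So a uniform matrix kills `v` with probability 2⁻ᵐ. -/
theorem card_mulVec_eq_zero {n : ℕ} (m : ℕ) {v : Fin n → Bit} (hv : v ≠ 0) :
    Fintype.card {Λ : Matrix (Fin m) (Fin n) Bit // Λ.mulVec v = 0} * 2 ^ m =
      Fintype.card (Matrix (Fin m) (Fin n) Bit) := by
  classical
  obtain ⟨k, hk⟩ := Function.ne_iff.1 hv
  have hk1 : v k = 1 := by
    have : ∀ b : Bit, b ≠ 0 → b = 1 := by decide
    exact this _ hk
  let L : (Fin m → Bit) → Matrix (Fin m) (Fin n) Bit := fun u i j => if j = k then u i else 0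
  have hL : ∀ u, (L u).mulVec v = u := by
    intro u
    funext i
    simp [L, Matrix.mulVec, dotProduct, hk1]
  let e : {Λ : Matrix (Fin m) (Fin n) Bit // Λ.mulVec v = 0} × (Fin m → Bit) ≃
      Matrix (Fin m) (Fin n) Bit :=
    { toFun := fun x => x.1.1 + L x.2
      invFun := fun Λ => (⟨Λ - L (Λ.mulVec v), by rw [Matrix.sub_mulVec, hL, sub_self]⟩,
        Λ.mulVec v)
      left_inv := by
        rintro ⟨⟨Λ, h⟩, u⟩
        simp [Matrix.add_mulVec, hL, h]
      right_inv := fun Λ => by simp }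
  rw [← Fintype.card_congr e]
  simp

/-- A random linear map is a good compressor of any finite set of vectors. -/
theorem exists_linear_code {n : ℕ} (m : ℕ) (P : (Fin n → Bit) → ℝ) (hP : ∀ z, 0 ≤ P z)
    (hP1 : ∑ z, P z = 1) (A : Finset (Fin n → Bit)) :
    ∃ (Λ : Matrix (Fin m) (Fin n) Bit) (D : (Fin m → Bit) → (Fin n → Bit)),
      ∑ z, (if D (Λ.mulVec z) ≠ z then P z else 0) ≤
        ∑ z, (if z ∉ A then P z else 0) + A.card * (2 ^ m : ℝ)⁻¹ := by
  classical
  -- The expected number of other elements of `A` that share the syndrome of a random element of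
  -- `A`. Its average over Λ is at most |A| 2⁻ᵐ, so some Λ does at least as well.
  let col : Matrix (Fin m) (Fin n) Bit → ℝ := fun Λ =>
    ∑ z ∈ A, P z * ∑ z' ∈ A, if z' ≠ z ∧ Λ.mulVec (z' - z) = 0 then 1 else 0
  have hsum : ∑ Λ, col Λ ≤ ∑ _Λ : Matrix (Fin m) (Fin n) Bit, A.card * (2 ^ m : ℝ)⁻¹ := by
    have h1 : ∀ z z', ∑ Λ : Matrix (Fin m) (Fin n) Bit,
        (if z' ≠ z ∧ Λ.mulVec (z' - z) = 0 then (1 : ℝ) else 0) ≤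
        Fintype.card (Matrix (Fin m) (Fin n) Bit) * (2 ^ m : ℝ)⁻¹ := by
      intro z z'
      by_cases hz : z' = z
      · simp only [hz, ne_eq, not_true_eq_false, false_and, if_false, Finset.sum_const_zero]
        positivity
      · have h2 := card_mulVec_eq_zero m (sub_ne_zero.2 hz)
        rw [← h2]
        simp only [ne_eq, hz, not_false_eq_true, true_and, Finset.sum_boole]
        rw [Fintype.card_subtype]
        push_cast
        rw [mul_assoc, mul_inv_cancel₀ (by positivity), mul_one]
    calc ∑ Λ, col Λ = ∑ z ∈ A, P z * ∑ z' ∈ A, ∑ Λ : Matrix (Fin m) (Fin n) Bit,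
          (if z' ≠ z ∧ Λ.mulVec (z' - z) = 0 then (1 : ℝ) else 0) := by
          simp only [col]
          rw [Finset.sum_comm]
          refine Finset.sum_congr rfl fun z _ => ?_
          rw [← Finset.mul_sum, Finset.sum_comm]
      _ ≤ ∑ z ∈ A, P z * ∑ _z' ∈ A,
          (Fintype.card (Matrix (Fin m) (Fin n) Bit) * (2 ^ m : ℝ)⁻¹) := by
          gcongr with z _ z' _
          · exact hP z
          · exact h1 z z'
      _ ≤ 1 * (A.card * (Fintype.card (Matrix (Fin m) (Fin n) Bit) * (2 ^ m : ℝ)⁻¹)) := by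
          rw [← Finset.sum_mul, Finset.sum_const, nsmul_eq_mul]
          gcongr
          rw [← hP1]
          exact Finset.sum_le_univ_sum_of_nonneg hP
      _ = _ := by
          rw [Finset.sum_const, nsmul_eq_mul, Finset.card_univ]
          ring
  obtain ⟨Λ, -, hΛ⟩ := Finset.exists_le_of_sum_le Finset.univ_nonempty hsum
  let D : (Fin m → Bit) → (Fin n → Bit) := fun s =>
    if h : ∃ z ∈ A, Λ.mulVec z = s then h.choose else 0
  refine ⟨Λ, D, ?_⟩
  have key : ∀ z, (if D (Λ.mulVec z) ≠ z then P z else 0) ≤ (if z ∉ A then P z else 0) +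
      if z ∈ A then P z * ∑ z' ∈ A, (if z' ≠ z ∧ Λ.mulVec (z' - z) = 0 then (1 : ℝ) else 0)
      else 0 := by
    intro z
    by_cases hz : z ∈ A
    · simp only [hz, not_true_eq_false, if_false, if_true, zero_add]
      split_ifs with hD
      -- If the decoder errs at some z in `A`, the element that it chose is itself a collision.
      · have hex : ∃ z' ∈ A, Λ.mulVec z' = Λ.mulVec z := ⟨z, hz, rfl⟩
        have hDz : D (Λ.mulVec z) = hex.choose := dif_pos hex
        refine le_mul_of_one_le_right (hP z) ?_
        refine le_trans ?_ (Finset.single_le_sum (f := fun z' =>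
          if z' ≠ z ∧ Λ.mulVec (z' - z) = 0 then (1 : ℝ) else 0)
          (fun z' _ => by positivity) hex.choose_spec.1)
        have h0 : Λ.mulVec (hex.choose - z) = 0 := by
          rw [Matrix.mulVec_sub, hex.choose_spec.2, sub_self]
        rw [if_pos ⟨hDz ▸ hD, h0⟩]
      · exact mul_nonneg (hP z) (Finset.sum_nonneg fun z' _ => by positivity)
    · simp only [hz, not_false_eq_true, if_true, if_false, add_zero]
      split_ifs
      · exact le_rfl
      · exact hP z
  refine (Finset.sum_le_sum fun z _ => key z).trans ?_
  rw [Finset.sum_add_distrib]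
  gcongr
  refine le_trans (le_of_eq ?_) hΛ
  simp [col]

/-- A Chernoff bound: a mass Q below θ satisfies Q ≤ θˢ Q¹⁻ˢ, and the sum of the powers factors over
the coordinates. -/
theorem sum_prob_lt_le {α : Type*} [Fintype α] (q : α → ℝ) (hq : ∀ a, 0 ≤ q a) (n : ℕ)
    {s θ : ℝ} (hs0 : 0 < s) (hθ : 0 < θ) :
    ∑ a : Fin n → α, (if ∏ k, q (a k) < θ then ∏ k, q (a k) else 0) ≤
      θ ^ s * (∑ a, q a ^ (1 - s)) ^ n := by
  rw [← sum_prod_eq_pow, Finset.mul_sum]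
  refine Finset.sum_le_sum fun a _ => ?_
  have h0 : 0 ≤ ∏ k, q (a k) := Finset.prod_nonneg fun k _ => hq _
  rw [Real.finsetProd_rpow _ _ fun k _ => hq _]
  split_ifs with h
  · calc ∏ k, q (a k) = (∏ k, q (a k)) ^ s * (∏ k, q (a k)) ^ (1 - s) := by
          rw [← Real.rpow_add' h0 (by simp)]
          simp
      _ ≤ _ := by gcongr
  · positivity

theorem hasDerivAt_rpow_one_sub {q : ℝ} (hq : 0 ≤ q) :
    HasDerivAt (fun s : ℝ => q ^ (1 - s)) (Real.negMulLog q) 0 := by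
  rcases hq.eq_or_lt with rfl | hq
  · rw [Real.negMulLog_zero]
    refine (hasDerivAt_const (0 : ℝ) (0 : ℝ)).congr_of_eventuallyEq ?_
    filter_upwards [Iio_mem_nhds (zero_lt_one' ℝ)] with s hs
    exact Real.zero_rpow (sub_pos.2 hs).ne'
  · have := ((hasDerivAt_id (0 : ℝ)).const_sub 1).const_rpow hq
    simp only [id_eq, sub_zero, Real.rpow_one] at this
    convert this using 1
    rw [Real.negMulLog]
    ring

/-- As a function of s, the expression is 1 at 0 with derivative entropy minus c, which is negative.
Entropy is in nats here. -/
theorem exists_moment_lt_one {α : Type*} [Fintype α] (q : α → ℝ) (hq : ∀ a, 0 ≤ q a)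
    (hq1 : ∑ a, q a = 1) {c : ℝ} (hc : ∑ a, Real.negMulLog (q a) < c) :
    ∃ s, 0 < s ∧ s < 1 ∧ Real.exp (-(s * c)) * ∑ a, q a ^ (1 - s) < 1 := by
  let f : ℝ → ℝ := fun s => Real.exp (-(s * c)) * ∑ a, q a ^ (1 - s)
  have hf0 : f 0 = 1 := by simp [f, hq1]
  have hd : HasDerivAt f (∑ a, Real.negMulLog (q a) - c) 0 := by
    have h1 : HasDerivAt (fun s : ℝ => Real.exp (-(s * c))) (-c) 0 := by
      have := (((hasDerivAt_id (0 : ℝ)).mul_const c).neg).exp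
      simpa using this
    have h2 : HasDerivAt (fun s : ℝ => ∑ a, q a ^ (1 - s)) (∑ a, Real.negMulLog (q a)) 0 :=
      HasDerivAt.fun_sum fun a _ => hasDerivAt_rpow_one_sub (hq a)
    refine HasDerivAt.congr_deriv (f := f) (h1.mul h2) ?_
    simp [hq1]
    ring
  have hslope := (hasDerivAt_iff_tendsto_slope.1 hd).eventually_lt_const (sub_neg.2 hc)
  have h2 : ∀ᶠ s in 𝓝[>] (0 : ℝ), slope f 0 s < 0 :=
    hslope.filter_mono (nhdsWithin_mono _ fun s hs => ne_of_gt hs)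
  obtain ⟨s, h, hs0, hs1⟩ := (h2.and (Ioo_mem_nhdsGT (zero_lt_one' ℝ))).exists
  refine ⟨s, hs0, hs1, ?_⟩
  rw [slope_def_field, hf0, sub_zero, div_neg_iff] at h
  rcases h with h | h
  · exact absurd h.2 (not_lt.2 hs0.le)
  · linarith [h.1]

/-- Linear codes compress the sums of the bits of the source at every rate above `H₂(p)`. -/
theorem exists_linear_codes {p : ℝ} (hp0 : 0 ≤ p) (hp1 : p ≤ 1 / 2) {R : ℝ} (hR : H2 p < R) :
    ∃ (m : ℕ → ℕ) (Λ : (n : ℕ) → Matrix (Fin (m n)) (Fin n) Bit)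
      (D : (n : ℕ) → (Fin (m n) → Bit) → (Fin n → Bit)), (∀ n, (m n : ℝ) ≤ n * R) ∧
      Tendsto (fun n => ∑ z : Fin n → Bit,
        (if D n ((Λ n).mulVec z) ≠ z then ∏ k, sumPMF p (z k) else 0)) atTop (𝓝 0) := by
  classical
  have hR0 : 0 ≤ R := (H2_nonneg hp0 hp1).trans hR.le
  have hl := log_two_pos
  have hb : ∑ b, Real.negMulLog (sumPMF p b) < R * Real.log 2 := by
    rw [← sum_negMulLog_sumPMF, div_lt_iff₀ hl] at hR
    exact hR
  -- As c exceeds the entropy, sequences of mass below e⁻ⁿᶜ have vanishing total mass; as c < R log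
  -- 2, the at most eⁿᶜ others are far fewer than the syndromes.
  obtain ⟨c, hc1, hc2⟩ := exists_between hb
  obtain ⟨s, hs0, hs1, hs⟩ := exists_moment_lt_one (sumPMF p) (sumPMF_nonneg hp0 hp1)
    (sum_sumPMF p) hc1
  set g := ∑ b, sumPMF p b ^ (1 - s) with hg
  have hg0 : 0 ≤ g := Finset.sum_nonneg fun b _ => Real.rpow_nonneg (sumPMF_nonneg hp0 hp1 b) _
  have hPn : ∀ n (z : Fin n → Bit), 0 ≤ ∏ k, sumPMF p (z k) := fun n z =>
    Finset.prod_nonneg fun k _ => sumPMF_nonneg hp0 hp1 _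
  have hP1 : ∀ n, ∑ z : Fin n → Bit, ∏ k, sumPMF p (z k) = 1 := fun n => by
    rw [sum_prod_eq_pow, sum_sumPMF, one_pow]
  let θ : ℕ → ℝ := fun n => Real.exp (-(n * c))
  let A : (n : ℕ) → Finset (Fin n → Bit) := fun n =>
    Finset.univ.filter fun z => θ n ≤ ∏ k, sumPMF p (z k)
  let m : ℕ → ℕ := fun n => ⌊n * R⌋₊
  choose Λ D h using fun n => exists_linear_code (m n) (fun z => ∏ k, sumPMF p (z k)) (hPn n)
    (hP1 n) (A n)
  refine ⟨m, Λ, D, fun n => Nat.floor_le (by positivity), ?_⟩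
  have hA : ∀ n, ((A n).card : ℝ) ≤ Real.exp (n * c) := by
    intro n
    have h1 : (A n).card * θ n ≤ 1 := by
      rw [← hP1 n, ← nsmul_eq_mul]
      refine (Finset.card_nsmul_le_sum _ _ _ fun z hz => ?_).trans
        (Finset.sum_le_univ_sum_of_nonneg (hPn n))
      exact (Finset.mem_filter.1 hz).2
    rw [← le_div_iff₀ (Real.exp_pos _), one_div, ← Real.exp_neg, neg_neg] at h1
    exact h1
  have htail : ∀ n, ∑ z : Fin n → Bit, (if z ∉ A n then ∏ k, sumPMF p (z k) else 0) ≤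
      (Real.exp (-(s * c)) * g) ^ n := by
    intro n
    have := sum_prob_lt_le (sumPMF p) (sumPMF_nonneg hp0 hp1) n hs0 (Real.exp_pos (-(n * c)))
    rw [← hg, ← Real.exp_mul] at this
    refine le_trans (le_of_eq (Finset.sum_congr rfl fun z _ => ?_)) (this.trans_eq ?_)
    · simp [A, θ]
    · rw [mul_pow, ← Real.exp_nat_mul]
      congr 2
      ring
  have hcol : ∀ n, (A n).card * (2 ^ m n : ℝ)⁻¹ ≤ 2 * Real.exp (c - R * Real.log 2) ^ n := by
    intro n
    -- Rounding nR down loses less than one bit, hence the factor 2.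
    have h2 : Real.exp (n * R * Real.log 2) ≤ 2 * 2 ^ m n := by
      have h3 : n * R ≤ m n + 1 := (Nat.lt_floor_add_one _).le
      calc Real.exp (n * R * Real.log 2) ≤ Real.exp ((m n + 1) * Real.log 2) := by gcongr
        _ = 2 * 2 ^ m n := by
          rw [add_mul, one_mul, Real.exp_add, Real.exp_nat_mul, Real.exp_log two_pos, mul_comm]
    have h4 : (2 ^ m n : ℝ)⁻¹ ≤ 2 * Real.exp (-(n * R * Real.log 2)) := by
      rw [Real.exp_neg, ← div_eq_mul_inv, le_div_iff₀ (Real.exp_pos _),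
        inv_mul_le_iff₀ (by positivity)]
      linarith
    calc (A n).card * (2 ^ m n : ℝ)⁻¹
        ≤ Real.exp (n * c) * (2 * Real.exp (-(n * R * Real.log 2))) := by
          gcongr
          exact hA n
      _ = _ := by
          rw [mul_left_comm, ← Real.exp_add, ← Real.exp_nat_mul]
          congr 2
          ring
  have hlim : Tendsto (fun n : ℕ => (Real.exp (-(s * c)) * g) ^ n +
      2 * Real.exp (c - R * Real.log 2) ^ n) atTop (𝓝 0) := by
    have h1 := tendsto_pow_atTop_nhds_zero_of_lt_one (by positivity) hs
    have h2 := (tendsto_pow_atTop_nhds_zero_of_lt_one (Real.exp_pos _).le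
      (Real.exp_lt_one_iff.2 (sub_neg.2 hc2))).const_mul 2
    simpa using h1.add h2
  refine squeeze_zero (fun n => Finset.sum_nonneg fun z _ => ?_) (fun n => (h n).trans
    (add_le_add (htail n) (hcol n))) hlim
  split_ifs
  · exact hPn n z
  · exact le_rfl

/-! ### The masked syndrome protocol -/

theorem toVec_ofFn {m : ℕ} (v : Fin m → Bit) : toVec m (List.ofFn v) = v := by
  funext k
  simp [toVec]

/-- The transcript of a link on which only `v` is sent, in round `t₀`. -/
def oneShot {m : ℕ} (t₀ : ℕ) (v : Fin m → Bit) : ℕ → List Bit × List Bit :=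
  fun t => (if t = t₀ then List.ofFn v else [], [])

theorem oneShot_injective {m : ℕ} (t₀ : ℕ) :
    Function.Injective (oneShot t₀ : (Fin m → Bit) → ℕ → List Bit × List Bit) := by
  intro v w h
  have := congrFun h t₀
  simp only [oneShot, if_true, Prod.mk.injEq, and_true] at this
  exact List.ofFn_injective this

/-- A conditional mutual information vanishes if the joint law factors. -/
theorem condMutualInfo_eq_zero_of_factor {Ω α β τ : Type*} [MeasurableSpace Ω] {μ : Measure Ω}
    [IsFiniteMeasure μ] [Finite τ] {S : Ω → α} {T : Ω → τ} {U : Ω → β} (hS : IsDiscrete μ S)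
    (hT : IsDiscrete μ T) (hU : IsDiscrete μ U)
    (h : ∀ c, ∃ (f : α → ℝ≥0∞) (g : τ → ℝ≥0∞), ∀ a b,
      μ (U ⁻¹' {c} ∩ S ⁻¹' {a} ∩ T ⁻¹' {b}) = f a * g b) :
    condMutualInfo μ S T U = 0 := by
  unfold condMutualInfo
  rw [condEntropy_prod_right_of_condIndep hS hU, tsub_self]
  intro a b c
  obtain ⟨f, g, hfg⟩ := h c
  exact measure_inter_mul_eq_of_factor hS hT id c f g hfg a b

theorem uniformOn_univ_preimage_add {m : ℕ} (A : Set (Fin m → Bit)) (u : Fin m → Bit) :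
    uniformOn Set.univ {K : Fin m → Bit | K + u ∈ A} = uniformOn Set.univ A := by
  rw [uniformOn_univ, uniformOn_univ]
  congr 1
  have : {K : Fin m → Bit | K + u ∈ A} = (fun K => K - u) '' A := by
    ext K
    simp [sub_eq_iff_eq_add]
  rw [this, Measure.count_injective_image (sub_left_injective)]

namespace maskedSyndrome

open Protocol

variable {n m : ℕ} (Λ : Matrix (Fin m) (Fin n) Bit) (D : (Fin m → Bit) → (Fin n → Bit)) {p : ℝ}

/-- The key drawn by Alice. -/
def key (ω : (maskedSyndrome Λ D).Sample) : Fin m → Bit := ω.2 0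

theorem sent_zero (ω : (maskedSyndrome Λ D).Sample) (i j : User) :
    (maskedSyndrome Λ D).sent ω 0 i j =
      if i = 0 ∧ j = 1 then List.ofFn (key Λ D ω)
      else if i = 0 ∧ j = 2 then List.ofFn (key Λ D ω + Λ.mulVec ((maskedSyndrome Λ D).X ω))
      else [] := by
  unfold sent nextRound
  fin_cases i <;> fin_cases j <;> simp [history, maskedSyndrome, input, key]

theorem sent_one (ω : (maskedSyndrome Λ D).Sample) (i j : User) :
    (maskedSyndrome Λ D).sent ω 1 i j =
      if i = 1 ∧ j = 2 then List.ofFn (key Λ D ω + Λ.mulVec ((maskedSyndrome Λ D).Y ω))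
      else [] := by
  have h1 : (maskedSyndrome Λ D).history ω 1 = [(maskedSyndrome Λ D).sent ω 0] := rfl
  have h2 : (maskedSyndrome Λ D).sent ω 0 0 1 = List.ofFn (key Λ D ω) := by
    rw [sent_zero]; simp
  rw [sent, nextRound, h1]
  fin_cases i <;> fin_cases j <;> simp [maskedSyndrome, input, key]
  erw [h2]
  rw [toVec_ofFn]
  rfl

theorem sent_of_two_le (ω : (maskedSyndrome Λ D).Sample) {t : ℕ} (ht : 2 ≤ t) (i j : User) :
    (maskedSyndrome Λ D).sent ω t i j = [] := by
  have hl : ((maskedSyndrome Λ D).history ω t).length = t := by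
    rw [history_eq_map]; simp
  rw [sent, nextRound]
  split_ifs with hij
  · rfl
  · have : ∀ x r h, 2 ≤ h.length → (maskedSyndrome Λ D).msg i j x r h = [] := by
      intro x r h hh
      have h0 : h.length ≠ 0 := by omega
      have h1 : h.length ≠ 1 := by omega
      simp only [maskedSyndrome, h0, h1, false_and, if_false]
    exact this _ _ _ (by rw [List.length_map, hl]; exact ht)

theorem length_sent (ω : (maskedSyndrome Λ D).Sample) (t : ℕ) (i j : User) :
    ((maskedSyndrome Λ D).sent ω t i j).length = maskedLength m t i j := by
  rcases t with _ | _ | t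
  · rw [sent_zero]
    fin_cases i <;> fin_cases j <;> simp [maskedLength]
  · rw [sent_one]
    fin_cases i <;> fin_cases j <;> simp [maskedLength]
  · rw [sent_of_two_le _ _ _ (by omega)]
    simp [maskedLength]

theorem isValid (p : ℝ) : (maskedSyndrome Λ D).IsValid p where
  sent_mem_code := Eventually.of_forall fun ω t i j _ => by
    change _ = maskedLength m _ i j
    rw [length_sent, List.length_map, history_eq_map]
    simp
  terminates := Eventually.of_forall fun ω => ⟨2, fun t ht i j => sent_of_two_le Λ D ω ht i j⟩

theorem transcript02 (ω : (maskedSyndrome Λ D).Sample) :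
    (maskedSyndrome Λ D).transcript 0 2 ω =
      oneShot 0 (key Λ D ω + Λ.mulVec ((maskedSyndrome Λ D).X ω)) := by
  funext t
  rcases t with _ | _ | t
  · simp [transcript, sent_zero, oneShot]
  · simp [transcript, sent_one, oneShot]
  · simp [transcript, sent_of_two_le, oneShot]

theorem transcript12 (ω : (maskedSyndrome Λ D).Sample) :
    (maskedSyndrome Λ D).transcript 1 2 ω =
      oneShot 1 (key Λ D ω + Λ.mulVec ((maskedSyndrome Λ D).Y ω)) := by
  funext t
  rcases t with _ | _ | t
  · simp [transcript, sent_zero, oneShot]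
  · simp [transcript, sent_one, oneShot]
  · simp [transcript, sent_of_two_le, oneShot]

theorem transcript01 (ω : (maskedSyndrome Λ D).Sample) :
    (maskedSyndrome Λ D).transcript 0 1 ω = oneShot 0 (key Λ D ω) := by
  funext t
  rcases t with _ | _ | t
  · simp [transcript, sent_zero, oneShot]
  · simp [transcript, sent_one, oneShot]
  · simp [transcript, sent_of_two_le, oneShot]

theorem linkLength_eq (ω : (maskedSyndrome Λ D).Sample) {i j : User}
    (hij : (i = 0 ∧ j = 2) ∨ (i = 1 ∧ j = 2) ∨ (i = 0 ∧ j = 1)) :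
    (maskedSyndrome Λ D).linkLength i j ω = m := by
  unfold linkLength
  simp only [length_sent]
  rw [tsum_eq_sum (s := Finset.range 2)]
  · rcases hij with ⟨rfl, rfl⟩ | ⟨rfl, rfl⟩ | ⟨rfl, rfl⟩ <;>
      simp [maskedLength]
  · intro t ht
    have h0 : t ≠ 0 := by rintro rfl; simp at ht
    have h1 : t ≠ 1 := by rintro rfl; simp at ht
    simp [maskedLength, h0, h1]

theorem linkRate_eq (hp0 : 0 ≤ p) (hp1 : p ≤ 1 / 2) {i j : User}
    (hij : (i = 0 ∧ j = 2) ∨ (i = 1 ∧ j = 2) ∨ (i = 0 ∧ j = 1)) :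
    (maskedSyndrome Λ D).linkRate p i j = (m : ℝ≥0∞) / n := by
  have := (maskedSyndrome Λ D).isProbabilityMeasure_measure hp0 hp1
  unfold linkRate
  simp only [linkLength_eq Λ D _ hij]
  rw [lintegral_const, measure_univ, mul_one]

theorem isDiscrete_key (μ : Measure (maskedSyndrome Λ D).Sample) : IsDiscrete μ (key Λ D) :=
  IsDiscrete.of_countable fun K => (maskedSyndrome Λ D).measurableSet_sample fun _ =>
    measurable_pi_apply (0 : User) (MeasurableSet.of_discrete (s := ({K} : Set (Fin m → Bit))))

/-- Once the inputs are fixed, the three transcripts are an injective function of the m-bit key. -/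
theorem randRate_le (hp0 : 0 ≤ p) (hp1 : p ≤ 1 / 2) :
    (maskedSyndrome Λ D).randRate p ≤ (m : ℝ≥0∞) / n := by
  have := (maskedSyndrome Λ D).isProbabilityMeasure_measure hp0 hp1
  have hU := ((maskedSyndrome Λ D).isDiscrete_X ((maskedSyndrome Λ D).measure p)).prodMk
    ((maskedSyndrome Λ D).isDiscrete_Y ((maskedSyndrome Λ D).measure p))
  unfold Protocol.randRate
  gcongr
  rw [condEntropy_comp_of_injective (S := key Λ D) hU.1
    (fun u K => (oneShot 0 (K + Λ.mulVec u.1), oneShot 1 (K + Λ.mulVec u.2), oneShot 0 K))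
    (fun u K K' h => oneShot_injective 0 (Prod.ext_iff.1 (Prod.ext_iff.1 h).2).2)
    (fun ω => by rw [transcript02, transcript12, transcript01]), ← log_card_bits m]
  exact condEntropy_le_log_card (isDiscrete_key Λ D _) hU

theorem measure_singleton_prod_key (hp0 : 0 ≤ p) (hp1 : p ≤ 1 / 2) (s : Fin n → Bit × Bit)
    (A : Set (Fin m → Bit)) :
    (maskedSyndrome Λ D).measure p ({s} ×ˢ {r | r 0 ∈ A}) =
      Measure.pi (fun _ : Fin n => dsbs p) {s} * uniformOn Set.univ A := by
  rw [(maskedSyndrome Λ D).measure_singleton_prod hp0 hp1]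
  congr 1
  have h := measure_pi_eq_mul (maskedSyndrome Λ D).law 0 (F := A) (G := Set.univ) (by simp)
  simp only [Set.mem_univ, and_true, measure_univ, mul_one] at h
  exact h

theorem sample_eq_iff (s : Fin n → Bit × Bit) (r : ∀ i, (maskedSyndrome Λ D).Rand i)
    (x y : Fin n → Bit) : s = (fun k => (x k, y k)) ↔
      (maskedSyndrome Λ D).X (s, r) = x ∧ (maskedSyndrome Λ D).Y (s, r) = y := by
  constructor
  · rintro rfl; exact ⟨rfl, rfl⟩
  · rintro ⟨rfl, rfl⟩; rfl

/-- For fixed X the view is a function of the key, which is independent of the source. -/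
theorem leakAlice_eq_zero (hp0 : 0 ≤ p) (hp1 : p ≤ 1 / 2) :
    (maskedSyndrome Λ D).leakAlice p = 0 := by
  have := (maskedSyndrome Λ D).isProbabilityMeasure_measure hp0 hp1
  have hP := isValid Λ D p
  refine condMutualInfo_eq_zero_of_factor
    ((hP.isDiscrete_transcript 0 2).prodMk (hP.isDiscrete_transcript 0 1))
    ((maskedSyndrome Λ D).isDiscrete_Y _) ((maskedSyndrome Λ D).isDiscrete_X _) fun x =>
    ⟨fun a => uniformOn Set.univ {K | (oneShot 0 (K + Λ.mulVec x), oneShot 0 K) = a},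
      fun y => Measure.pi (fun _ : Fin n => dsbs p) {fun k => (x k, y k)}, fun a y => ?_⟩
  rw [mul_comm, ← measure_singleton_prod_key Λ D hp0 hp1]
  congr 1
  ext ⟨s, r⟩
  simp only [Set.mem_inter_iff, Set.mem_preimage, Set.mem_singleton_iff, Set.mem_prod,
    Set.mem_ofPred_eq, sample_eq_iff Λ D s r, transcript02, transcript01]
  constructor
  · rintro ⟨⟨rfl, h⟩, rfl⟩
    exact ⟨⟨rfl, rfl⟩, h⟩
  · rintro ⟨⟨rfl, rfl⟩, h⟩
    exact ⟨⟨rfl, h⟩, rfl⟩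

theorem leakBob_eq_zero (hp0 : 0 ≤ p) (hp1 : p ≤ 1 / 2) :
    (maskedSyndrome Λ D).leakBob p = 0 := by
  have := (maskedSyndrome Λ D).isProbabilityMeasure_measure hp0 hp1
  have hP := isValid Λ D p
  refine condMutualInfo_eq_zero_of_factor
    ((hP.isDiscrete_transcript 1 2).prodMk (hP.isDiscrete_transcript 0 1))
    ((maskedSyndrome Λ D).isDiscrete_X _) ((maskedSyndrome Λ D).isDiscrete_Y _) fun y =>
    ⟨fun a => uniformOn Set.univ {K | (oneShot 1 (K + Λ.mulVec y), oneShot 0 K) = a},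
      fun x => Measure.pi (fun _ : Fin n => dsbs p) {fun k => (x k, y k)}, fun a x => ?_⟩
  rw [mul_comm, ← measure_singleton_prod_key Λ D hp0 hp1]
  congr 1
  ext ⟨s, r⟩
  simp only [Set.mem_inter_iff, Set.mem_preimage, Set.mem_singleton_iff, Set.mem_prod,
    Set.mem_ofPred_eq, sample_eq_iff Λ D s r, transcript12, transcript01]
  constructor
  · rintro ⟨⟨rfl, h⟩, rfl⟩
    exact ⟨⟨rfl, rfl⟩, h⟩
  · rintro ⟨⟨rfl, rfl⟩, h⟩
    exact ⟨⟨rfl, h⟩, rfl⟩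

/-- For inputs x and y with sum z the view is (K + Λx, K + Λy). As K + Λx is again uniform, this has
the law of (K, K + Λz), which depends on z only. -/
theorem leakCharlie_eq_zero (hp0 : 0 ≤ p) (hp1 : p ≤ 1 / 2) :
    (maskedSyndrome Λ D).leakCharlie p = 0 := by
  classical
  have := (maskedSyndrome Λ D).isProbabilityMeasure_measure hp0 hp1
  have hP := isValid Λ D p
  refine condMutualInfo_eq_zero_of_factor
    ((hP.isDiscrete_transcript 0 2).prodMk (hP.isDiscrete_transcript 1 2))
    (((maskedSyndrome Λ D).isDiscrete_X _).prodMk ((maskedSyndrome Λ D).isDiscrete_Y _))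
    ((maskedSyndrome Λ D).isDiscrete_Z _) fun z =>
    ⟨fun a => uniformOn Set.univ {K | (oneShot 0 K, oneShot 1 (K + Λ.mulVec z)) = a},
      fun w => if w.1 + w.2 = z then
        Measure.pi (fun _ : Fin n => dsbs p) {fun k => (w.1 k, w.2 k)} else 0, fun a w => ?_⟩
  obtain ⟨x, y⟩ := w
  dsimp only
  split_ifs with hz
  · have hshift := uniformOn_univ_preimage_add
      {K | (oneShot 0 K, oneShot 1 (K + Λ.mulVec z)) = a} (Λ.mulVec x)
    have hy : ∀ K : Fin m → Bit, K + Λ.mulVec x + Λ.mulVec z = K + Λ.mulVec y := by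
      intro K
      have h2 : Λ.mulVec x + Λ.mulVec x = 0 := funext fun _ => CharTwo.add_self_eq_zero _
      rw [← hz, Matrix.mulVec_add, add_assoc, ← add_assoc (Λ.mulVec x), h2, zero_add]
    simp only [Set.mem_ofPred_eq, hy] at hshift
    rw [← hshift, mul_comm, ← measure_singleton_prod_key Λ D hp0 hp1]
    congr 1
    ext ⟨s, r⟩
    simp only [Set.mem_inter_iff, Set.mem_preimage, Set.mem_singleton_iff, Set.mem_prod,
      Set.mem_ofPred_eq, sample_eq_iff Λ D s r, transcript12, transcript02, Prod.mk.injEq]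
    constructor
    · rintro ⟨⟨-, h⟩, rfl, rfl⟩
      exact ⟨⟨rfl, rfl⟩, h⟩
    · rintro ⟨⟨rfl, rfl⟩, h⟩
      exact ⟨⟨hz, h⟩, rfl, rfl⟩
  · rw [mul_zero]
    convert measure_empty (μ := (maskedSyndrome Λ D).measure p) using 2
    ext ω
    simp only [Set.mem_inter_iff, Set.mem_preimage, Set.mem_singleton_iff, Prod.mk.injEq,
      Set.mem_empty_iff_false, iff_false]
    rintro ⟨⟨h, -⟩, rfl, rfl⟩
    exact hz h

theorem estimate_eq (ω : (maskedSyndrome Λ D).Sample) :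
    (maskedSyndrome Λ D).estimate ω = D (Λ.mulVec ((maskedSyndrome Λ D).Z ω)) := by
  change D (toVec m ((maskedSyndrome Λ D).sent ω 0 0 2) +
    toVec m ((maskedSyndrome Λ D).sent ω 1 1 2)) = _
  have h2 : key Λ D ω + key Λ D ω = 0 := funext fun _ => CharTwo.add_self_eq_zero _
  rw [sent_zero, sent_one]
  simp only [true_and, if_true, Fin.reduceEq, if_false, toVec_ofFn]
  rw [add_add_add_comm, h2, zero_add, ← Matrix.mulVec_add]
  rfl

theorem errorProb_eq (hp0 : 0 ≤ p) (hp1 : p ≤ 1 / 2) :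
    (maskedSyndrome Λ D).errorProb p = ENNReal.ofReal
      (∑ z : Fin n → Bit, (if D (Λ.mulVec z) ≠ z then ∏ k, sumPMF p (z k) else 0)) := by
  have hn : ∀ z : Fin n → Bit, 0 ≤ ∏ k, sumPMF p (z k) := fun z =>
    Finset.prod_nonneg fun k _ => sumPMF_nonneg hp0 hp1 _
  rw [ENNReal.ofReal_sum_of_nonneg fun z _ => by split_ifs <;> simp [hn], errorProb,
    ← ((maskedSyndrome Λ D).isDiscrete_Z _).tsum_inter, tsum_fintype]
  refine Finset.sum_congr rfl fun z _ => ?_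
  split_ifs with h
  · rw [ENNReal.ofReal_prod_of_nonneg fun k _ => sumPMF_nonneg hp0 hp1 _,
      ← (maskedSyndrome Λ D).measure_Z hp0 hp1]
    congr 1
    ext ω
    simp only [Set.mem_inter_iff, Set.mem_preimage, Set.mem_singleton_iff, Set.mem_ofPred_eq,
      estimate_eq, and_iff_right_iff_imp]
    rintro rfl
    exact h
  · rw [ENNReal.ofReal_zero]
    convert measure_empty (μ := (maskedSyndrome Λ D).measure p) using 2
    ext ω
    simp only [Set.mem_inter_iff, Set.mem_preimage, Set.mem_singleton_iff, Set.mem_ofPred_eq,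
      estimate_eq, Set.mem_empty_iff_false, iff_false]
    rintro ⟨h1, rfl⟩
    exact h h1

end maskedSyndrome

/-! ### Achievability -/

theorem coe_le_of_le_ofReal {x : ℝ≥0∞} {R : ℝ} (hR : 0 ≤ R) (h : x ≤ ENNReal.ofReal R) :
    (x : EReal) ≤ (R : EReal) := by
  refine (EReal.coe_ennreal_le_coe_ennreal_iff.2 h).trans_eq ?_
  rw [EReal.coe_ennreal_ofReal, max_eq_left hR]

theorem le_ofReal_of_coe_le {x : ℝ≥0∞} {R : ℝ} (h : (x : EReal) ≤ (R : EReal)) :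
    0 ≤ R ∧ x ≤ ENNReal.ofReal R := by
  have h0 : 0 ≤ R := by
    have := (EReal.coe_ennreal_nonneg x).trans h
    exact_mod_cast this
  refine ⟨h0, ?_⟩
  rw [← EReal.coe_ennreal_le_coe_ennreal_iff, EReal.coe_ennreal_ofReal, max_eq_left h0]
  exact h

theorem exists_maskedSyndrome {p : ℝ} (hp0 : 0 ≤ p) (hp1 : p ≤ 1 / 2) {R : ℝ} (hR : H2 p < R) :
    ∃ (m : ℕ → ℕ) (Λ : (n : ℕ) → Matrix (Fin (m n)) (Fin n) Bit)
      (D : (n : ℕ) → (Fin (m n) → Bit) → (Fin n → Bit)), (∀ n, (m n : ℝ) ≤ n * R) ∧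
      Attains p (fun n => maskedSyndrome (Λ n) (D n)) (R, R, R, R) ∧
      IsPerfectlyPrivate p (fun n => maskedSyndrome (Λ n) (D n)) := by
  obtain ⟨m, Λ, D, hm, hlim⟩ := exists_linear_codes hp0 hp1 hR
  have hR0 : 0 ≤ R := (H2_nonneg hp0 hp1).trans hR.le
  have hrate : ∀ n, 0 < n → ((m n : ℝ≥0∞) / n) ≤ ENNReal.ofReal R := by
    intro n hn
    refine ENNReal.div_le_of_le_mul ?_
    rw [← ENNReal.ofReal_natCast, ← ENNReal.ofReal_natCast, ← ENNReal.ofReal_mul hR0]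
    exact ENNReal.ofReal_le_ofReal ((hm n).trans_eq (mul_comm _ _))
  have hlink : ∀ n, 0 < n → ∀ i j : User,
      ((i = 0 ∧ j = 2) ∨ (i = 1 ∧ j = 2) ∨ (i = 0 ∧ j = 1)) →
      ((maskedSyndrome (Λ n) (D n)).linkRate p i j : EReal) ≤ (R : EReal) := fun n hn i j hij =>
    coe_le_of_le_ofReal hR0 ((maskedSyndrome.linkRate_eq _ _ hp0 hp1 hij).le.trans (hrate n hn))
  refine ⟨m, Λ, D, hm, ?_, ?_⟩
  · exact
    { valid := fun n _ => maskedSyndrome.isValid _ _ p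
      rate13 := fun n hn => hlink n hn 0 2 (by simp)
      rate23 := fun n hn => hlink n hn 1 2 (by simp)
      rate12 := fun n hn => hlink n hn 0 1 (by simp)
      randRate := fun n hn =>
        coe_le_of_le_ofReal hR0 ((maskedSyndrome.randRate_le _ _ hp0 hp1).trans (hrate n hn))
      error := by
        simp only [maskedSyndrome.errorProb_eq _ _ hp0 hp1]
        rw [← ENNReal.ofReal_zero]
        exact (ENNReal.continuous_ofReal.tendsto 0).comp hlim }
  · exact
    { alice := fun n _ => maskedSyndrome.leakAlice_eq_zero _ _ hp0 hp1
      bob := fun n _ => maskedSyndrome.leakBob_eq_zero _ _ hp0 hp1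
      charlie := fun n _ => maskedSyndrome.leakCharlie_eq_zero _ _ hp0 hp1 }

theorem Attains.mono {p : ℝ} {S : (n : ℕ) → Protocol n} {q q' : ℝ × ℝ × ℝ × ℝ}
    (h : Attains p S q) (h1 : q.1 ≤ q'.1) (h2 : q.2.1 ≤ q'.2.1) (h3 : q.2.2.1 ≤ q'.2.2.1)
    (h4 : q.2.2.2 ≤ q'.2.2.2) : Attains p S q' where
  valid := h.valid
  rate13 := fun n hn => (h.rate13 n hn).trans (EReal.coe_le_coe_iff.2 h1)
  rate23 := fun n hn => (h.rate23 n hn).trans (EReal.coe_le_coe_iff.2 h2)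
  rate12 := fun n hn => (h.rate12 n hn).trans (EReal.coe_le_coe_iff.2 h3)
  randRate := fun n hn => (h.randRate n hn).trans (EReal.coe_le_coe_iff.2 h4)
  error := h.error

/-- The codes need a rate strictly above H₂(p). Raising all coordinates by δ > 0 provides it, and
the closure absorbs δ. -/
theorem subset_perfectRateRegion {p : ℝ} (hp0 : 0 ≤ p) (hp1 : p ≤ 1 / 2) :
    {q | H2 p ≤ min (min q.1 q.2.1) (min q.2.2.1 q.2.2.2)} ⊆ perfectRateRegion p := by
  intro q hq
  simp only [Set.mem_ofPred_eq, le_min_iff] at hq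
  obtain ⟨⟨h1, h2⟩, h3, h4⟩ := hq
  have hlim : Tendsto (fun δ : ℝ => (q.1 + δ, q.2.1 + δ, q.2.2.1 + δ, q.2.2.2 + δ)) (𝓝[>] 0)
      (𝓝 q) := by
    have hc : Continuous fun δ : ℝ => (q.1 + δ, q.2.1 + δ, q.2.2.1 + δ, q.2.2.2 + δ) := by
      fun_prop
    have := hc.tendsto 0
    simp only [add_zero] at this
    exact this.mono_left nhdsWithin_le_nhds
  refine mem_closure_of_tendsto hlim ?_
  filter_upwards [self_mem_nhdsWithin] with δ hδ
  have hδ : 0 < δ := hδ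
  obtain ⟨m, Λ, D, -, hA, hP⟩ := exists_maskedSyndrome hp0 hp1 (lt_add_of_pos_right (H2 p) hδ)
  exact ⟨_, hA.mono (by simpa using h1) (by simpa using h2) (by simpa using h3)
    (by simpa using h4), hP⟩

theorem IsPerfectlyPrivate.isPrivate {p : ℝ} {S : (n : ℕ) → Protocol n}
    (h : IsPerfectlyPrivate p S) : IsPrivate p S where
  alice := tendsto_const_nhds.congr' <| by
    filter_upwards [eventually_gt_atTop 0] with n hn using (h.alice n hn).symm
  bob := tendsto_const_nhds.congr' <| by
    filter_upwards [eventually_gt_atTop 0] with n hn using (h.bob n hn).symm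
  charlie := tendsto_const_nhds.congr' <| by
    filter_upwards [eventually_gt_atTop 0] with n hn using (h.charlie n hn).symm

theorem tendsto_div_natCast {a : ℕ → ℝ≥0∞} (h : Tendsto a atTop (𝓝 0)) :
    Tendsto (fun n => a n / n) atTop (𝓝 0) := by
  refine tendsto_of_tendsto_of_tendsto_of_le_of_le' tendsto_const_nhds h
    (Eventually.of_forall fun n => zero_le) ?_
  filter_upwards [eventually_gt_atTop 0] with n hn
  refine ENNReal.div_le_of_le_mul ?_
  exact le_mul_of_one_le_right zero_le (by exact_mod_cast hn)

theorem IsPrivate.isWeaklyPrivate {p : ℝ} {S : (n : ℕ) → Protocol n}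
    (h : IsPrivate p S) : IsWeaklyPrivate p S where
  alice := tendsto_div_natCast h.alice
  bob := tendsto_div_natCast h.bob
  charlie := tendsto_div_natCast h.charlie

/-! ### The converse -/

/-- The total error term of the converse vanishes relative to the block length. -/
theorem tendsto_converse_error {p : ℝ} {S : (n : ℕ) → Protocol n} {q : ℝ × ℝ × ℝ × ℝ}
    (hA : Attains p S q) (hW : IsWeaklyPrivate p S) :
    Tendsto (fun n : ℕ => ((S n).leakAlice p + (S n).leakBob p + (S n).leakCharlie p +
      (1 + (S n).errorProb p * n)) / n) atTop (𝓝 0) := by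
  have h1 : Tendsto (fun n : ℕ => (1 : ℝ≥0∞) / n) atTop (𝓝 0) := by
    simpa using ENNReal.tendsto_inv_nat_nhds_zero
  have h := ((hW.alice.add hW.bob).add hW.charlie).add (h1.add hA.error)
  simp only [add_zero] at h
  refine h.congr' ?_
  filter_upwards [eventually_gt_atTop 0] with n hn
  have hn0 : (n : ℝ≥0∞) ≠ 0 := by exact_mod_cast hn.ne'
  simp only [ENNReal.div_add_div_same]
  rw [ENNReal.add_div (b := 1 + _), ENNReal.add_div (a := 1),
    ENNReal.mul_div_cancel_right hn0 (ENNReal.natCast_ne_top n)]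

theorem le_of_forall_rate {h R : ℝ} {e r : ℕ → ℝ≥0∞}
    (he : Tendsto (fun n => e n / n) atTop (𝓝 0))
    (hr : ∀ n, 0 < n → (r n : EReal) ≤ (R : EReal))
    (hb : ∀ n : ℕ, 0 < n → (n : ℝ≥0∞) * ENNReal.ofReal h ≤ r n * n + e n) : h ≤ R := by
  -- Without this, `ENNReal.ofReal` would not distinguish a negative R from 0.
  have h0 : 0 ≤ R := (le_ofReal_of_coe_le (hr 1 one_pos)).1
  have key : ENNReal.ofReal h ≤ ENNReal.ofReal R := by
    have hlim : Tendsto (fun n : ℕ => ENNReal.ofReal R + e n / n) atTop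
        (𝓝 (ENNReal.ofReal R + 0)) := he.const_add _
    rw [add_zero] at hlim
    refine ge_of_tendsto hlim ?_
    filter_upwards [eventually_gt_atTop 0] with n hn
    have hn0 : (n : ℝ≥0∞) ≠ 0 := by exact_mod_cast hn.ne'
    have hnt : (n : ℝ≥0∞) ≠ ⊤ := ENNReal.natCast_ne_top n
    refine le_trans ?_ (add_le_add (le_ofReal_of_coe_le (hr n hn)).2 le_rfl)
    have := ENNReal.div_le_div_right (hb n hn) n
    rwa [ENNReal.add_div, ENNReal.mul_div_cancel_right hn0 hnt, mul_comm,
      ENNReal.mul_div_cancel_right hn0 hnt] at this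
  exact (ENNReal.ofReal_le_ofReal_iff h0).1 key

/-- The limiting set is closed, so achievable points suffice. The four bounds have different error
terms, all dominated by the one of the randomness bound. -/
theorem weakRateRegion_subset {p : ℝ} (hp0 : 0 ≤ p) (hp1 : p ≤ 1 / 2) :
    weakRateRegion p ⊆ {q | H2 p ≤ min (min q.1 q.2.1) (min q.2.2.1 q.2.2.2)} := by
  refine closure_minimal ?_ (isClosed_le continuous_const (by fun_prop))
  rintro q ⟨S, hA, hW⟩
  have he := tendsto_converse_error hA hW
  have hmul : ∀ n : ℕ, 0 < n → ∀ x : ℝ≥0∞, x / n * n = x := fun n hn x =>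
    ENNReal.div_mul_cancel (by exact_mod_cast hn.ne') (ENNReal.natCast_ne_top n)
  simp only [Set.mem_ofPred_eq, le_min_iff]
  refine ⟨⟨le_of_forall_rate he hA.rate13 fun n hn => ?_,
    le_of_forall_rate he hA.rate23 fun n hn => ?_⟩,
    le_of_forall_rate he hA.rate12 fun n hn => ?_,
    le_of_forall_rate he hA.randRate fun n hn => ?_⟩
  · rw [Protocol.linkRate, hmul n hn]
    refine ((hA.valid n hn).le_entropy_transcript02 hp0 hp1).trans (add_le_add
      ((hA.valid n hn).entropy_transcript_le hp0 hp1 (by decide)) (add_le_add ?_ le_rfl))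
    exact le_add_right le_add_self
  · rw [Protocol.linkRate, hmul n hn]
    refine ((hA.valid n hn).le_entropy_transcript12 hp0 hp1).trans (add_le_add
      ((hA.valid n hn).entropy_transcript_le hp0 hp1 (by decide)) (add_le_add ?_ le_rfl))
    exact le_add_right le_self_add
  · rw [Protocol.linkRate, hmul n hn]
    refine ((hA.valid n hn).le_entropy_transcript01 hp0 hp1).trans (add_le_add
      ((hA.valid n hn).entropy_transcript_le hp0 hp1 (by decide)) (add_le_add ?_ le_rfl))
    exact add_le_add le_self_add le_rfl
  · rw [Protocol.randRate, hmul n hn]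
    exact (hA.valid n hn).le_condEntropy_transcripts hp0 hp1

theorem perfectRateRegion_subset (p : ℝ) : perfectRateRegion p ⊆ rateRegion p :=
  closure_mono fun _ ⟨S, hA, hP⟩ => ⟨S, hA, hP.isPrivate⟩

theorem rateRegion_subset (p : ℝ) : rateRegion p ⊆ weakRateRegion p :=
  closure_mono fun _ ⟨S, hA, hP⟩ => ⟨S, hA, hP.isWeaklyPrivate⟩

end SecureXor

end

theorem theorem1 (p : ℝ) (hp0 : 0 ≤ p) (hp1 : p ≤ 1 / 2) :
    SecureXor.entropy (SecureXor.dsbs p) (fun a => a.1 + a.2) = ENNReal.ofReal (SecureXor.H2 p) ∧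
    SecureXor.rateRegion p =
      {q | SecureXor.H2 p ≤ min (min q.1 q.2.1) (min q.2.2.1 q.2.2.2)} ∧
    SecureXor.weakRateRegion p =
      {q | SecureXor.H2 p ≤ min (min q.1 q.2.1) (min q.2.2.1 q.2.2.2)} ∧
    SecureXor.perfectRateRegion p =
      {q | SecureXor.H2 p ≤ min (min q.1 q.2.1) (min q.2.2.1 q.2.2.2)} ∧
    ∀ R : ℝ, SecureXor.H2 p < R →
      ∃ (m : ℕ → ℕ) (Λ : (n : ℕ) → Matrix (Fin (m n)) (Fin n) SecureXor.Bit)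
        (D : (n : ℕ) → (Fin (m n) → SecureXor.Bit) → (Fin n → SecureXor.Bit)),
        (∀ n, (m n : ℝ) ≤ n * R) ∧
        SecureXor.Attains p (fun n => SecureXor.maskedSyndrome (Λ n) (D n)) (R, R, R, R) ∧
        SecureXor.IsPerfectlyPrivate p (fun n => SecureXor.maskedSyndrome (Λ n) (D n)) :=
  ⟨SecureXor.entropy_dsbs_sum hp0 hp1,
    (SecureXor.rateRegion_subset p |>.trans (SecureXor.weakRateRegion_subset hp0 hp1)).antisymm
      ((SecureXor.subset_perfectRateRegion hp0 hp1).trans (SecureXor.perfectRateRegion_subset p)),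
    (SecureXor.weakRateRegion_subset hp0 hp1).antisymm
      (((SecureXor.subset_perfectRateRegion hp0 hp1).trans
        (SecureXor.perfectRateRegion_subset p)).trans (SecureXor.rateRegion_subset p)),
    (((SecureXor.perfectRateRegion_subset p).trans (SecureXor.rateRegion_subset p)).trans
      (SecureXor.weakRateRegion_subset hp0 hp1)).antisymm
      (SecureXor.subset_perfectRateRegion hp0 hp1),
    fun _ hR => SecureXor.exists_maskedSyndrome hp0 hp1 hR⟩
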